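/- Let $g\ge 1$ and let $\Gamma$ be a chain of $g$ loops with bridges: for $1\le i\le g$ the $i$-th loop has two vertices $v_i,w_i$ joined by two edges of lengths $m_i>0$ and $\ell_i>0$, and for $1\le i<g$ the point $w_i$ is joined to $v_{i+1}$ by a bridge of length $\ge 0$ (a bridge of length $0$ is a point). Assume that no ratio $\ell_i/m_i$ equals a ratio of two positive integers whose sum is at most $2g-2$. Use the counterclockwise arc length coordinate in $\mathbb R/(\ell_i+m_i)\mathbb Z$ on the $i$-th loop, in which $v_i$ is $0$ and $w_i$ is $m_i$. Let $\operatorname{Pic}(\Gamma)$ be the group of divisors on $\Gamma$ modulo divisors of continuous piecewise linear functions with integer slopes. For $r\ge 0$ and $d\in\mathbb Z$ let $W^r_d(\Gamma)$ be the set of classes of degree $d$ and Baker–Norine rank at least $r$, let $\Theta_\Gamma=W^0_{g-1}(\Gamma)$, and let $\rho=g-(r+1)(g-d+r)$. An effective divisor is $v_1$-reduced if the multiset of distances from $v_1$ to its points is lexicographically minimal among the effective divisors equivalent to it. Every $v_1$-reduced divisor has the form $d_0v_1+\sum_{x_i\ne 0}x_i$, where $d_0\ge 0$ is an integer and $x_i\in\mathbb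 R/(\ell_i+m_i)\mathbb Z$ is regarded, when $x_i\neq 0$, as a point of the $i$-th loop. The associated lingering lattice path $p_0,\dots,p_g\in\mathbb Z^r$, with coordinates indexed by $0\le j\le r-1$, starts at $p_0=(d_0,d_0-1,\dots,d_0-r+1)$. Its $i$-th step $p_i-p_{i-1}$ is $(-1,\dots,-1)$ if $x_i=0$. If $x_i\ne0$, it is the standard basis vector $e_j$ if $x_i\equiv(p_{i-1}(j)+1)m_i$ modulo $\ell_i+m_i$ and both $p_{i-1}$ and $p_{i-1}+e_j$ lie in $\{y\in\mathbb Z^r: y_0>\dots>y_{r-1}>0\}$; and it is $0$ if there is no such $j$, in which case the step is called lingering. A divisor class of degree $d$ and rank exactly $r$ is vertex avoiding if, for its $v_1$-reduced representative, the path has exactly $\rho$ lingering steps, and $x_i\not\equiv m_i$ and $x_i\not\equiv p_{i-1}(j)\,m_i$ modulo $\ell_i+m_i$ for all $i$ and $j$. Fix for each $i$ a point $P_i$ in the interior of one of the two edges of the $i$-th loop. For a divisor $D$ and $\epsilon>0$ not exceeding the distance from any $P_i$ to $v_i$ and $w_i$, let $$B(D,\epsilon)=\Big\{\Big[D+\sum_{i=1}^g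 Q_i-\sum_{i=1}^g P_i\Big] : Q_i \text{ on the } i\text{-th loop},\ \operatorname{dist}(P_i,Q_i)<\epsilon\Big\}.$$ **Proposition.** Let $[D]\in W^r_d(\Gamma)$ be a vertex avoiding divisor class (of rank $r$). Then $g-\rho\ge 0$, and there are effective divisors $E_1,\dots,E_{g-\rho}$ of degree $r$ and effective divisors $E'_1,\dots,E'_{g-\rho}$ of degree $g-d+r-1$ such that for some such $\epsilon>0$, $$W^r_d(\Gamma)\cap B(D,\epsilon)=\bigcap_{i=1}^{g-\rho}\big[\Theta_\Gamma+E_i-E'_i\big]\cap B(D,\epsilon).$$ For $g-\rho=0$ the right-hand side is $B(D,\epsilon)$. -/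

import Mathlib

open Filter Topology

/-- The data of a chain of `g ≥ 1` loops with bridges. The `i`-th loop has two vertices `v i`, `w i`,
joined by an edge of length `m i` (traversed first when going counterclockwise from `v i`) and by an
edge of length `ell i`. The `i`-th bridge joins `w i` to `v (i+1)` and has length `b i ≥ 0`; a bridge
of length zero is a single point. Indices start at `0`. -/
structure ChainOfLoops (g : ℕ) where
  ell : Fin g → ℝ
  m : Fin g → ℝ
  b : Fin (g - 1) → ℝ
  genus_pos : 0 < g
  ell_pos : ∀ i, 0 < ell i
  m_pos : ∀ i, 0 < m i
  b_nonneg : ∀ i, 0 ≤ b i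

noncomputable section

namespace ChainOfLoops

variable {g : ℕ} (Γ : ChainOfLoops g)

/-- No ratio `ell i / m i` is a ratio of two positive integers whose sum is at most `2g - 2`. -/
def IsGeneric : Prop :=
  ∀ i : Fin g, ∀ s t : ℕ, 0 < s → 0 < t → s + t ≤ 2 * g - 2 → Γ.ell i / Γ.m i ≠ (s : ℝ) / (t : ℝ)

/-- The `i`-th loop, with the counterclockwise arc length coordinate from `v i`. Its distance is the
arc length distance of the circle. -/
abbrev Loop (i : Fin g) : Type := AddCircle (Γ.ell i + Γ.m i)

/-- The coordinate `k * m i` on the `i`-th loop. In particular `k = 1` is the vertex `w i`. -/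
def mult (i : Fin g) (k : ℤ) : Γ.Loop i := (((k : ℝ) * Γ.m i : ℝ) : AddCircle (Γ.ell i + Γ.m i))

/-- The loop at the left end of the `i`-th bridge. -/
def leftLoop (i : Fin (g - 1)) : Fin g := ⟨i, by omega⟩

/-- The loop at the right end of the `i`-th bridge. -/
def rightLoop (i : Fin (g - 1)) : Fin g := ⟨i + 1, by omega⟩

/-- The disjoint union of all loops and all bridges. -/
abbrev PrePoint : Type :=
  (Σ i : Fin g, Γ.Loop i) ⊕ (Σ i : Fin (g - 1), Set.Icc (0 : ℝ) (Γ.b i))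

/-- The `i`-th bridge starts at `w i` and ends at `v (i+1)`. -/
inductive Glue : Γ.PrePoint → Γ.PrePoint → Prop
  | left (i : Fin (g - 1)) :
      Glue (Sum.inr ⟨i, ⟨0, le_refl _, Γ.b_nonneg i⟩⟩) (Sum.inl ⟨leftLoop i, Γ.mult _ 1⟩)
  | right (i : Fin (g - 1)) :
      Glue (Sum.inr ⟨i, ⟨Γ.b i, Γ.b_nonneg i, le_refl _⟩⟩) (Sum.inl ⟨rightLoop i, 0⟩)

/-- The points of the metric graph: loops and bridges, glued at their common points. -/
def Point : Type := Quot Γ.Glue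

/-- The point with coordinate `x` on the `i`-th loop. -/
def loopPt (i : Fin g) (x : Γ.Loop i) : Γ.Point := Quot.mk _ (Sum.inl ⟨i, x⟩)

/-- The point at distance `t` from the left end of the `i`-th bridge. -/
def bridgePt (i : Fin (g - 1)) (t : Set.Icc (0 : ℝ) (Γ.b i)) : Γ.Point :=
  Quot.mk _ (Sum.inr ⟨i, t⟩)

/-- `bridgePt` with the parameter clipped to the bridge, so that a path leaving the bridge through
one of its ends stops there. -/
def bridgeClip (i : Fin (g - 1)) (t : ℝ) : Γ.Point :=
  Γ.bridgePt i (Set.projIcc 0 (Γ.b i) (Γ.b_nonneg i) t)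

def v (i : Fin g) : Γ.Point := Γ.loopPt i 0

/-- The leftmost vertex. -/
def v₁ : Γ.Point := Γ.v ⟨0, Γ.genus_pos⟩

/-! Divisors, linear equivalence, and the Picard group. -/

/-- Divisors; a divisor `D` is effective if `0 ≤ D`. -/
abbrev Divisor : Type := Γ.Point →₀ ℤ

variable {Γ} in
def deg (D : Γ.Divisor) : ℤ := D.sum fun _ n => n

/-- `φ` is affine of integer slope `s` on some interval `[0, δ)` with `δ > 0`. -/
def HasSlope (φ : ℝ → ℝ) (s : ℤ) : Prop := ∀ᶠ h in 𝓝[>] (0 : ℝ), φ h = φ 0 + s * h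

/-- `f` is a rational function on the graph (continuous, piecewise linear with integer slopes), and
`D` is its divisor, whose value at a point is the sum of the outgoing slopes of `f` along the tangent
directions at that point. Each loop and each bridge contributes the tangent directions along itself.
A clipped path stands still beyond an end of a bridge, hence the nonexistent tangent direction there
contributes the slope `0`. Continuity and finiteness of the number of linear pieces follow from
local linearity along all tangent directions, by compactness. -/
def IsDivisorOf (f : Γ.Point → ℝ) (D : Γ.Divisor) : Prop :=
  ∃ (a : ∀ i : Fin g, Γ.Loop i →₀ ℤ) (c : ∀ i : Fin (g - 1), Set.Icc (0 : ℝ) (Γ.b i) →₀ ℤ),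
    (∀ i x, ∃ s t : ℤ,
      HasSlope (fun h => f (Γ.loopPt i (x + (h : AddCircle (Γ.ell i + Γ.m i))))) s ∧
      HasSlope (fun h => f (Γ.loopPt i (x - (h : AddCircle (Γ.ell i + Γ.m i))))) t ∧
      a i x = s + t) ∧
    (∀ i (x : Set.Icc (0 : ℝ) (Γ.b i)), ∃ s t : ℤ,
      HasSlope (fun h => f (Γ.bridgeClip i (x + h))) s ∧
      HasSlope (fun h => f (Γ.bridgeClip i (x - h))) t ∧
      c i x = s + t) ∧
    D = ∑ i, (a i).mapDomain (Γ.loopPt i) + ∑ i, (c i).mapDomain (Γ.bridgePt i)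

theorem HasSlope.zero : HasSlope (fun _ => 0) 0 := by simp [HasSlope]

theorem HasSlope.add {φ ψ : ℝ → ℝ} {s t : ℤ} (hφ : HasSlope φ s) (hψ : HasSlope ψ t) :
    HasSlope (fun h => φ h + ψ h) (s + t) := by
  filter_upwards [hφ, hψ] with h h1 h2
  rw [h1, h2]; push_cast; ring

theorem HasSlope.neg {φ : ℝ → ℝ} {s : ℤ} (hφ : HasSlope φ s) :
    HasSlope (fun h => -φ h) (-s) := by
  filter_upwards [hφ] with h h1
  rw [h1]; push_cast; ring

/-- The group of principal divisors. -/
def principal : AddSubgroup Γ.Divisor where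
  carrier := {D | ∃ f : Γ.Point → ℝ, Γ.IsDivisorOf f D}
  zero_mem' := ⟨fun _ => 0, 0, 0, fun _ _ => ⟨0, 0, HasSlope.zero, HasSlope.zero, by simp⟩,
    fun _ _ => ⟨0, 0, HasSlope.zero, HasSlope.zero, by simp⟩, by simp⟩
  add_mem' := by
    rintro D D' ⟨f, a, c, ha, hc, rfl⟩ ⟨f', a', c', ha', hc', rfl⟩
    refine ⟨fun P => f P + f' P, a + a', c + c', fun i x => ?_, fun i x => ?_, ?_⟩
    · obtain ⟨s, t, h1, h2, h3⟩ := ha i x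
      obtain ⟨s', t', h1', h2', h3'⟩ := ha' i x
      exact ⟨s + s', t + t', h1.add h1', h2.add h2', by simp [h3, h3']; ring⟩
    · obtain ⟨s, t, h1, h2, h3⟩ := hc i x
      obtain ⟨s', t', h1', h2', h3'⟩ := hc' i x
      exact ⟨s + s', t + t', h1.add h1', h2.add h2', by simp [h3, h3']; ring⟩
    · simp only [Pi.add_apply, Finsupp.mapDomain_add, Finset.sum_add_distrib]
      abel
  neg_mem' := by
    rintro D ⟨f, a, c, ha, hc, rfl⟩
    refine ⟨fun P => -f P, -a, -c, fun i x => ?_, fun i x => ?_, ?_⟩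
    · obtain ⟨s, t, h1, h2, h3⟩ := ha i x
      exact ⟨-s, -t, h1.neg, h2.neg, by simp [h3]; ring⟩
    · obtain ⟨s, t, h1, h2, h3⟩ := hc i x
      exact ⟨-s, -t, h1.neg, h2.neg, by simp [h3]; ring⟩
    · have key : ∀ {α β : Type} (u : α → β) (e : α →₀ ℤ),
          (-e).mapDomain u = -(e.mapDomain u) := fun u e =>
        map_neg (Finsupp.mapDomain.addMonoidHom u) e
      simp only [Pi.neg_apply, key, Finset.sum_neg_distrib]
      abel

/-- Divisors modulo linear equivalence, in all degrees. -/
abbrev Pic : Type := Γ.Divisor ⧸ Γ.principal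

variable {Γ} in
/-- The class of a divisor. -/
def cls (D : Γ.Divisor) : Γ.Pic := QuotientAddGroup.mk D

/-- The (Baker-Norine) rank of a divisor class is at least `r`: after subtracting any effective
divisor of degree `r`, the class still contains an effective divisor. -/
def RankAtLeast (r : ℕ) (c : Γ.Pic) : Prop :=
  ∀ E : Γ.Divisor, 0 ≤ E → deg E = r → ∃ D : Γ.Divisor, 0 ≤ D ∧ cls D = c - cls E

/-- The rank of a divisor class equals `r`, where `r ≥ 0`. -/
def HasRank (r : ℕ) (c : Γ.Pic) : Prop := IsGreatest {k : ℕ | Γ.RankAtLeast k c} r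

/-- The Brill-Noether locus: divisor classes of degree `d` and rank at least `r`. -/
def W (r : ℕ) (d : ℤ) : Set Γ.Pic :=
  {c | (∃ D : Γ.Divisor, deg D = d ∧ cls D = c) ∧ Γ.RankAtLeast r c}

/-- The theta divisor. -/
def Theta : Set Γ.Pic := Γ.W 0 ((g : ℤ) - 1)

/-- The neighborhood `B(c, ε)` of the class `c`, consisting of all `c + ∑ q i - ∑ p i` with `q i` on
the `i`-th loop at distance less than `ε` from `p i`. -/
def B (p : ∀ i, Γ.Loop i) (c : Γ.Pic) (ε : ℝ) : Set Γ.Pic :=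
  {c' | ∃ q : ∀ i, Γ.Loop i, (∀ i, dist (p i) (q i) < ε) ∧
    c' = c + cls (∑ i, Finsupp.single (Γ.loopPt i (q i)) 1
      - ∑ i, Finsupp.single (Γ.loopPt i (p i)) 1)}

/-! Reduced divisors, lingering lattice paths, and vertex avoiding classes. -/

/-- The distance from `v₁` to `v i`. -/
def distV (i : ℕ) : ℝ :=
  ∑ k : Fin (g - 1), if (k : ℕ) < i then ‖Γ.mult (leftLoop k) 1‖ + Γ.b k else 0

/-- The distance from `v₁` to a point. -/
def dist₁ : Γ.Point → ℝ :=
  Quot.lift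
    (fun P => match P with
      | Sum.inl ⟨i, x⟩ => Γ.distV i + ‖x‖
      | Sum.inr ⟨i, t⟩ => Γ.distV i + ‖Γ.mult (leftLoop i) 1‖ + t)
    (by
      rintro _ _ (i | i)
      · simp [leftLoop]
      · have h : Γ.distV ((i : ℕ) + 1) = Γ.distV i + (‖Γ.mult (leftLoop i) 1‖ + Γ.b i) := by
          have h1 : ‖Γ.mult (leftLoop i) 1‖ + Γ.b i
              = ∑ k : Fin (g - 1), if k = i then ‖Γ.mult (leftLoop k) 1‖ + Γ.b k else 0 := by
            simp
          rw [h1]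
          unfold distV
          rw [← Finset.sum_add_distrib]
          refine Finset.sum_congr rfl fun k _ => ?_
          rcases lt_trichotomy (k : ℕ) i with hk | hk | hk
          · rw [if_pos (by omega), if_pos hk, if_neg (by rintro rfl; omega), add_zero]
          · have hk' : k = i := Fin.ext hk
            subst hk'
            simp
          · rw [if_neg (by omega), if_neg (by omega), if_neg (by rintro rfl; omega), add_zero]
        have h0 : ‖(0 : Γ.Loop (rightLoop i))‖ = 0 := norm_zero
        change Γ.distV i + ‖Γ.mult (leftLoop i) 1‖ + Γ.b i
          = Γ.distV ((i : ℕ) + 1) + ‖(0 : Γ.Loop (rightLoop i))‖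
        rw [h, h0, add_zero, add_assoc])

/-- `D` is `v₁`-reduced: it is effective, and the multiset of the distances from `v₁` to its points
is lexicographically minimal among the effective divisors equivalent to `D`. The multiset of distances
is encoded by its multiplicity function `D.mapDomain Γ.dist₁`; that of `D'` is smaller than that of `D`
if at the least distance where the multiplicities differ, the one of `D'` is larger. -/
def IsReduced (D : Γ.Divisor) : Prop :=
  0 ≤ D ∧ ∀ D' : Γ.Divisor, 0 ≤ D' → cls D' = cls D →
    ¬ ∃ t : ℝ, (∀ s < t, D'.mapDomain Γ.dist₁ s = D.mapDomain Γ.dist₁ s) ∧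
      D.mapDomain Γ.dist₁ t < D'.mapDomain Γ.dist₁ t

open Classical in
/-- The divisor represented by the data `(d₀, x)`: `d₀` chips at `v₁`, and on each loop with `x i ≠ 0`
one chip at the point with coordinate `x i`. -/
def dataDivisor (d₀ : ℕ) (x : ∀ i, Γ.Loop i) : Γ.Divisor :=
  Finsupp.single Γ.v₁ (d₀ : ℤ)
    + ∑ i, if x i = 0 then 0 else Finsupp.single (Γ.loopPt i (x i)) 1

/-- The open Weyl chamber `y 0 > y 1 > ⋯ > y (r - 1) > 0`. -/
def chamber (r : ℕ) : Set (Fin r → ℤ) := {y | StrictAnti y ∧ ∀ j, 0 < y j}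

/-- The condition for a step in the direction `e j` at loop `i` from the lattice point `y`. -/
def CanStep {r : ℕ} (x : ∀ i, Γ.Loop i) (i : Fin g) (y : Fin r → ℤ) (j : Fin r) : Prop :=
  x i = Γ.mult i (y j + 1) ∧ y ∈ chamber r ∧ y + Pi.single j 1 ∈ chamber r

/-- `p 0, …, p g` is the lingering lattice path in `ℤ ^ r` associated to the data `(d₀, x)`. -/
def IsLatticePath {r : ℕ} (d₀ : ℕ) (x : ∀ i, Γ.Loop i) (p : Fin (g + 1) → Fin r → ℤ) : Prop :=
  (∀ j : Fin r, p 0 j = (d₀ : ℤ) - (j : ℕ)) ∧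
  ∀ i : Fin g,
    (x i = 0 ∧ p i.succ = p i.castSucc - 1) ∨
    (x i ≠ 0 ∧ ∃ j, Γ.CanStep x i (p i.castSucc) j ∧ p i.succ = p i.castSucc + Pi.single j 1) ∨
    (x i ≠ 0 ∧ (∀ j, ¬ Γ.CanStep x i (p i.castSucc) j) ∧ p i.succ = p i.castSucc)

/-- The Brill-Noether number. -/
def rho (g r : ℕ) (d : ℤ) : ℤ := (g : ℤ) - ((r : ℤ) + 1) * ((g : ℤ) - d + r)

/-- The class `c` (of degree `d`) has rank `r` and is vertex avoiding. A step is lingering if it is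
of the third kind above; the condition `x i ≠ 0` only matters for `r = 0`, where it tells the third
kind from the first. -/
def IsVertexAvoiding (r : ℕ) (d : ℤ) (c : Γ.Pic) : Prop :=
  Γ.HasRank r c ∧
  ∃ (d₀ : ℕ) (x : ∀ i, Γ.Loop i) (p : Fin (g + 1) → Fin r → ℤ),
    Γ.IsReduced (Γ.dataDivisor d₀ x) ∧ cls (Γ.dataDivisor d₀ x) = c ∧
    Γ.IsLatticePath d₀ x p ∧
    (Set.ncard {i : Fin g | x i ≠ 0 ∧ p i.succ = p i.castSucc} : ℤ) = rho g r d ∧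
    (∀ i, x i ≠ Γ.mult i 1) ∧
    (∀ i j, x i ≠ Γ.mult i (p i.castSucc j))

end ChainOfLoops

end

noncomputable section

/-! A divisor class on a chain of loops is determined by its degree and one coordinate `abel i` on
each loop, obtained by retracting the points of the divisor to that loop (`cls_eq_iff`). In these
coordinates effectivity is decided by a greedy process: carry all chips from left to right. If `k`
chips arrive at loop `i`, they pass without loss exactly when the coordinate is `k * m i`; otherwise
one chip is left behind. The class contains an effective divisor if and only if the final count
`leftWalk` is nonnegative (`exists_effective_iff`).

If g - d + r = 0, every class of degree d has rank at least r, and there is nothing to cut out.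
Otherwise, for the data (d₀, x) of a vertex avoiding class, counting steps gives d₀ = r and a path
in the chamber from (r, ..., 1) back to itself (`isTightPath`). Hence each direction e_j occurs as
often as (-1, ..., -1), namely g - d + r times. Passing to a nearby class replaces x_i by x_i + q_i
- p_i. Locally, W^r_d is given by the equations q_k = p_k for the g - ρ loops k that do not linger.

These equations suffice for rank at least r by `IsTightPath.rankAtLeast`: the walk of D - E is
bounded below by a coordinate of the path, whose index is the number of chips of E already passed.

For the theta divisors, a class of degree g - 1 whose coordinate on loop i is never (g - 1 - i) m_i
loses a chip on every loop and ends at -1 (`leftWalk_neg`). So Θ lies in a union of g coordinate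
conditions. For each loop k that does not linger, `IsTightPath.exists_translate` finds E and F such
that the given class, moved by F - E, satisfies the k-th condition and no other; for small ε only
the k-th can hold nearby, which forces q_k = p_k. The inclusion of W^r_d in each translate is
automatic: if the rank is at least r, then c - E is effective, and so is c - E + F. -/

namespace ChainOfLoops

/-! ### Piecewise linear functions of a real variable with integer slopes. -/

theorem hasSlope_right_iff {ψ : ℝ → ℝ} {x : ℝ} {s : ℤ} :
    HasSlope (fun h => ψ (x + h)) s ↔ ∀ᶠ y in 𝓝[>] x, ψ y = ψ x + s * (y - x) := by
  have h : 𝓝[>] x = map (x + ·) (𝓝[>] 0) := by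
    simp
  rw [h, eventually_map]
  simp [HasSlope]

theorem hasSlope_left_iff {ψ : ℝ → ℝ} {x : ℝ} {t : ℤ} :
    HasSlope (fun h => ψ (x - h)) t ↔ ∀ᶠ y in 𝓝[<] x, ψ y = ψ x + t * (x - y) := by
  have h : 𝓝[<] x = map (x - ·) (𝓝[>] 0) := by
    simp
  rw [h, eventually_map]
  simp [HasSlope]

theorem HasSlope.unique {φ : ℝ → ℝ} {s t : ℤ} (hs : HasSlope φ s) (ht : HasSlope φ t) : s = t := by
  have h : ∀ᶠ h in 𝓝[>] (0 : ℝ), 0 < h := self_mem_nhdsWithin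
  obtain ⟨h, h1, h2, h3⟩ := (hs.and (ht.and h)).exists
  have : (s : ℝ) * h = t * h := by linarith
  exact_mod_cast mul_right_cancel₀ h3.ne' this

theorem HasSlope.congr {φ φ' : ℝ → ℝ} {s : ℤ} (hs : HasSlope φ s)
    (h : ∀ᶠ h in 𝓝[>] (0 : ℝ), φ' h = φ h) (h0 : φ' 0 = φ 0) : HasSlope φ' s := by
  filter_upwards [hs, h] with h h1 h2
  rw [h2, h1, h0]

theorem HasSlope.sum {ι : Type*} (S : Finset ι) {φ : ι → ℝ → ℝ} {s : ι → ℤ}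
    (h : ∀ i ∈ S, HasSlope (φ i) (s i)) :
    HasSlope (fun h => ∑ i ∈ S, φ i h) (∑ i ∈ S, s i) := by
  classical
  induction S using Finset.induction_on with
  | empty => simpa using HasSlope.zero
  | insert i S hi ih =>
    simp only [Finset.sum_insert hi]
    exact (h i (by simp)).add (ih fun j hj => h j (by simp [hj]))

theorem HasSlope.const_mul {φ : ℝ → ℝ} {s : ℤ} (n : ℤ) (h : HasSlope φ s) :
    HasSlope (fun h => n * φ h) (n * s) := by
  filter_upwards [h] with h h1
  rw [h1]; push_cast; ring

theorem hasSlope_const (a : ℝ) : HasSlope (fun _ => a) 0 := by simp [HasSlope]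

/-- The right slope of the ramp with corner `b`. -/
theorem hasSlope_ramp_right (b x : ℝ) :
    HasSlope (fun h => max (x + h - b) 0) (if b ≤ x then 1 else 0) := by
  rw [hasSlope_right_iff (ψ := fun y => max (y - b) 0)]
  split_ifs with h
  · filter_upwards [self_mem_nhdsWithin] with y hy
    have hy : x < y := hy
    rw [max_eq_left (by linarith), max_eq_left (by linarith)]; push_cast; ring
  · push Not at h
    filter_upwards [mem_nhdsWithin_of_mem_nhds (Iio_mem_nhds h)] with y hy
    have hy : y < b := hy
    rw [max_eq_right (by linarith), max_eq_right (by linarith)]; simp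

/-- The left slope of the ramp with corner `b`. -/
theorem hasSlope_ramp_left (b x : ℝ) :
    HasSlope (fun h => max (x - h - b) 0) (if b < x then -1 else 0) := by
  rw [hasSlope_left_iff (ψ := fun y => max (y - b) 0)]
  split_ifs with h
  · filter_upwards [mem_nhdsWithin_of_mem_nhds (Ioi_mem_nhds h)] with y hy
    have hy : b < y := hy
    rw [max_eq_left (by linarith), max_eq_left (by linarith)]; push_cast; ring
  · push Not at h
    filter_upwards [self_mem_nhdsWithin] with y hy
    have hy : y < x := hy
    rw [max_eq_right (by linarith), max_eq_right (by linarith)]; simp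

theorem eventually_nhdsWithin_Icc {A B x : ℝ} {q : ℝ → Prop} (hx : q x)
    (hr : ∀ᶠ y in 𝓝[>] x, q y) (hl : A < x → ∀ᶠ y in 𝓝[<] x, q y) (hA : A ≤ x) :
    ∀ᶠ y in 𝓝[Set.Icc A B] x, q y := by
  rcases hA.lt_or_eq with h | rfl
  · refine mem_nhdsWithin_of_mem_nhds ?_
    rw [← nhdsNE_sup_pure, ← nhdsLT_sup_nhdsGT]
    exact ⟨⟨hl h, hr⟩, hx⟩
  · have : ∀ᶠ y in 𝓝[≥] A, q y := by
      rw [← Set.Ioi_insert, nhdsWithin_insert]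
      exact ⟨hx, hr⟩
    exact nhdsWithin_mono _ Set.Icc_subset_Ici_self this

/-- A function with integer slopes in both directions that has no break points is affine. -/
theorem affine_of_slopes {ψ : ℝ → ℝ} {A B : ℝ} (hAB : A < B) (s t : ℝ → ℤ)
    (hs : ∀ x ∈ Set.Ico A B, HasSlope (fun h => ψ (x + h)) (s x))
    (ht : ∀ x ∈ Set.Ioc A B, HasSlope (fun h => ψ (x - h)) (t x))
    (hst : ∀ x ∈ Set.Ioo A B, s x + t x = 0) :
    (∀ x ∈ Set.Icc A B, ψ x = ψ A + s A * (x - A)) ∧ t B = -s A := by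
  -- The right slope is locally constant from the right by linearity, and from the left because
  -- there is no break point (`hl` below). It is therefore constant, which is deduced from the
  -- vanishing of its right derivative.
  have hr : ∀ x ∈ Set.Ico A B, ∀ᶠ y in 𝓝[>] x, s y = s x := by
    intro x hx
    have h1 := hasSlope_right_iff.1 (hs x hx)
    obtain ⟨δ, hδ, hsub⟩ := mem_nhdsGT_iff_exists_Ioo_subset.1 h1
    filter_upwards [Ioo_mem_nhdsGT (lt_min hδ hx.2)] with y hy
    have hyB : y ∈ Set.Ico A B := ⟨by linarith [hx.1, hy.1], lt_of_lt_of_le hy.2 (min_le_right _ _)⟩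
    have hyδ : y < δ := lt_of_lt_of_le hy.2 (min_le_left _ _)
    refine (hs y hyB).unique (hasSlope_right_iff.2 ?_)
    filter_upwards [Ioo_mem_nhdsGT hyδ] with z hz
    have e1 : ψ y = _ := hsub ⟨hy.1, hyδ⟩
    have e2 : ψ z = _ := hsub ⟨hy.1.trans hz.1, hz.2⟩
    rw [e1, e2]; ring
  have hl' : ∀ x ∈ Set.Ioc A B, ∀ᶠ y in 𝓝[<] x, s y = -t x := by
    intro x hx
    have h1 := hasSlope_left_iff.1 (ht x hx)
    obtain ⟨δ, hδ, hsub⟩ := mem_nhdsLT_iff_exists_Ioo_subset.1 h1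
    filter_upwards [Ioo_mem_nhdsLT (max_lt hδ hx.1)] with y hy
    have hyB : y ∈ Set.Ico A B := ⟨(lt_of_le_of_lt (le_max_right _ _) hy.1).le, hy.2.trans_le hx.2⟩
    have hyδ : δ < y := lt_of_le_of_lt (le_max_left _ _) hy.1
    refine (hs y hyB).unique (hasSlope_right_iff.2 ?_)
    filter_upwards [Ioo_mem_nhdsGT hy.2] with z hz
    have e1 : ψ y = _ := hsub ⟨hyδ, hy.2⟩
    have e2 : ψ z = _ := hsub ⟨hyδ.trans hz.1, hz.2⟩
    rw [e1, e2]; push_cast; ring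
  have hl : ∀ x ∈ Set.Ioo A B, ∀ᶠ y in 𝓝[<] x, s y = s x := by
    intro x hx
    filter_upwards [hl' x ⟨hx.1, hx.2.le⟩] with y hy
    have := hst x hx
    omega
  have hconst : ∀ x ∈ Set.Ico A B, s x = s A := by
    intro x hx
    have hx' : x ∈ Set.Icc A x := ⟨hx.1, le_rfl⟩
    have := constant_of_has_deriv_right_zero (f := fun y => (s y : ℝ)) (a := A) (b := x) ?_ ?_ x hx'
    · exact_mod_cast this
    · intro y hy
      have : ∀ᶠ z in 𝓝[Set.Icc A x] y, s z = s y :=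
        eventually_nhdsWithin_Icc rfl (hr y ⟨hy.1, hy.2.trans_lt hx.2⟩)
          (fun h => hl y ⟨h, hy.2.trans_lt hx.2⟩) hy.1
      refine (continuousWithinAt_const (b := (s y : ℝ))).congr_of_eventuallyEq ?_ rfl
      filter_upwards [this] with z hz
      rw [hz]
    · intro y hy
      have : ∀ᶠ z in 𝓝[≥] y, s z = s y := by
        rw [← Set.Ioi_insert, nhdsWithin_insert]
        exact ⟨rfl, hr y ⟨hy.1, hy.2.trans hx.2⟩⟩
      refine (hasDerivWithinAt_const y _ (s y : ℝ)).congr_of_eventuallyEq ?_ rfl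
      filter_upwards [this] with z hz
      rw [hz]
  have haff : ∀ x ∈ Set.Icc A B, ψ x - s A * (x - A) = ψ A := by
    have := constant_of_has_deriv_right_zero (f := fun y => ψ y - s A * (y - A)) (a := A) (b := B)
      ?_ ?_
    · intro x hx
      simpa using this x hx
    · have hcont : ContinuousOn ψ (Set.Icc A B) := by
        intro y hy
        have hright : y < B → Tendsto ψ (𝓝[>] y) (𝓝 (ψ y)) := by
          intro h
          have h1 := hasSlope_right_iff.1 (hs y ⟨hy.1, h⟩)
          have h2 : Tendsto (fun z => ψ y + s y * (z - y)) (𝓝[>] y) (𝓝 (ψ y + s y * (y - y))) :=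
            ((by fun_prop : Continuous fun z => ψ y + s y * (z - y)).tendsto y).mono_left
              nhdsWithin_le_nhds
          rw [sub_self, mul_zero, add_zero] at h2
          exact h2.congr' (by filter_upwards [h1] with z hz using hz.symm)
        have hleft : A < y → Tendsto ψ (𝓝[<] y) (𝓝 (ψ y)) := by
          intro h
          have h1 := hasSlope_left_iff.1 (ht y ⟨h, hy.2⟩)
          have h2 : Tendsto (fun z => ψ y + t y * (y - z)) (𝓝[<] y) (𝓝 (ψ y + t y * (y - y))) :=
            ((by fun_prop : Continuous fun z => ψ y + t y * (y - z)).tendsto y).mono_left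
              nhdsWithin_le_nhds
          rw [sub_self, mul_zero, add_zero] at h2
          exact h2.congr' (by filter_upwards [h1] with z hz using hz.symm)
        rcases hy.2.lt_or_eq with h | rfl
        · refine fun U hU => eventually_nhdsWithin_Icc (q := fun z => ψ z ∈ U)
            (show ψ y ∈ U from mem_of_mem_nhds hU) (hright h hU) (fun h' => hleft h' hU) hy.1
        · intro U hU
          have : ∀ᶠ z in 𝓝[≤] y, ψ z ∈ U := by
            rw [← Set.Iio_insert, nhdsWithin_insert]
            exact ⟨show ψ y ∈ U from mem_of_mem_nhds hU, hleft hAB hU⟩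
          exact nhdsWithin_mono _ Set.Icc_subset_Iic_self this
      exact hcont.sub (by fun_prop)
    · intro y hy
      have h1 := hasSlope_right_iff.1 (hs y hy)
      rw [hconst y hy] at h1
      have : ∀ᶠ z in 𝓝[≥] y, ψ z - s A * (z - A) = ψ y - s A * (y - A) := by
        rw [← Set.Ioi_insert, nhdsWithin_insert]
        refine ⟨rfl, ?_⟩
        filter_upwards [h1] with z hz
        rw [hz]; ring
      exact (hasDerivWithinAt_const y _ (ψ y - s A * (y - A))).congr_of_eventuallyEq this rfl
  refine ⟨fun x hx => by linarith [haff x hx], ?_⟩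
  refine (ht B ⟨hAB, le_rfl⟩).unique (hasSlope_left_iff.2 ?_)
  filter_upwards [Ioo_mem_nhdsLT hAB] with z hz
  have e1 := haff z ⟨hz.1.le, hz.2.le⟩
  have e2 := haff B ⟨hAB.le, le_rfl⟩
  push_cast
  linear_combination e1 - e2

end ChainOfLoops

/-! ### Principal divisors on a circle and on an interval. -/

namespace ChainOfLoops

section Circle

variable {L : ℝ} [hL : Fact (0 < L)]

/-- The representative in `[0, L)` of a point of the circle. -/
def rep (x : AddCircle L) : ℝ := AddCircle.equivIco L 0 x

theorem rep_nonneg (x : AddCircle L) : 0 ≤ rep x := (AddCircle.equivIco L 0 x).2.1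

theorem rep_lt (x : AddCircle L) : rep x < L :=
  (AddCircle.equivIco L 0 x).2.2.trans_eq (zero_add L)

theorem coe_rep (x : AddCircle L) : (rep x : AddCircle L) = x := AddCircle.coe_equivIco

theorem rep_coe {y : ℝ} (h0 : 0 ≤ y) (h1 : y < L) : rep (y : AddCircle L) = y := by
  have h : y ∈ Set.Ico 0 (0 + L) := ⟨h0, by simpa using h1⟩
  have := AddCircle.equivIco_coe_eq (p := L) (a := 0) h
  simp [rep, this]

theorem rep_eq_iff {x : AddCircle L} {y : ℝ} (h0 : 0 ≤ y) (h1 : y < L) : rep x = y ↔ x = y :=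
  ⟨fun h => by rw [← h, coe_rep], fun h => by rw [h, rep_coe h0 h1]⟩

/-- The sum of the ramps with corners at the points of `a`. -/
def rampSum (a : AddCircle L →₀ ℤ) (y : ℝ) : ℝ := ∑ x ∈ a.support, a x * max (y - rep x) 0

theorem rampSum_zero (a : AddCircle L →₀ ℤ) : rampSum a 0 = 0 := by
  refine Finset.sum_eq_zero fun x _ => ?_
  rw [max_eq_right (by linarith [rep_nonneg x]), mul_zero]

theorem rampSum_end (a : AddCircle L →₀ ℤ) :
    rampSum a L = (a.sum fun _ n => n : ℤ) * L - ∑ x ∈ a.support, a x * rep x := by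
  rw [rampSum, Finsupp.sum]
  push_cast
  rw [Finset.sum_mul, ← Finset.sum_sub_distrib]
  refine Finset.sum_congr rfl fun x _ => ?_
  rw [max_eq_left (by linarith [rep_lt x])]; ring

theorem rampSum_right (a : AddCircle L →₀ ℤ) (y : ℝ) :
    HasSlope (fun h => rampSum a (y + h)) (∑ x ∈ a.support, a x * if rep x ≤ y then 1 else 0) :=
  HasSlope.sum _ fun x _ => (hasSlope_ramp_right (rep x) y).const_mul (a x)

theorem rampSum_left (a : AddCircle L →₀ ℤ) (y : ℝ) :
    HasSlope (fun h => rampSum a (y - h)) (∑ x ∈ a.support, a x * if rep x < y then -1 else 0) :=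
  HasSlope.sum _ fun x _ => (hasSlope_ramp_left (rep x) y).const_mul (a x)

theorem rampSum_slope_zero (a : AddCircle L →₀ ℤ) :
    (∑ x ∈ a.support, a x * if rep x ≤ 0 then 1 else 0) = a 0 := by
  have : ∀ x ∈ a.support, (a x * if rep x ≤ 0 then 1 else 0) = if x = 0 then a x else 0 := by
    intro x _
    have : rep x ≤ 0 ↔ x = 0 := by
      rw [← QuotientAddGroup.mk_zero, ← rep_eq_iff le_rfl hL.out]
      exact ⟨fun h => le_antisymm h (rep_nonneg x), fun h => h.le⟩
    simp [this]
  rw [Finset.sum_congr rfl this, Finset.sum_ite_eq']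
  simp +contextual [eq_comm]

theorem rampSum_slope_end (a : AddCircle L →₀ ℤ) :
    (∑ x ∈ a.support, a x * if rep x < L then -1 else 0) = -a.sum fun _ n => n := by
  rw [Finsupp.sum, ← Finset.sum_neg_distrib]
  refine Finset.sum_congr rfl fun x _ => ?_
  rw [if_pos (rep_lt x)]; ring

theorem rampSum_slope_add (a : AddCircle L →₀ ℤ) {y : ℝ} (h0 : 0 < y) (h1 : y < L) :
    (∑ x ∈ a.support, a x * if rep x ≤ y then 1 else 0)
      + (∑ x ∈ a.support, a x * if rep x < y then -1 else 0) = a y := by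
  rw [← Finset.sum_add_distrib]
  have : ∀ x ∈ a.support, ((a x * if rep x ≤ y then 1 else 0) + (a x * if rep x < y then -1 else 0))
      = if x = y then a x else 0 := by
    intro x _
    simp only [← rep_eq_iff h0.le h1]
    rcases lt_trichotomy (rep x) y with h | h | h
    · simp [h, h.le, h.ne]
    · simp [h]
    · simp [h.not_ge, h.not_gt, h.ne']
  rw [Finset.sum_congr rfl this, Finset.sum_ite_eq']
  simp +contextual [eq_comm]

theorem coe_sum_rep (a : AddCircle L →₀ ℤ) :
    ((∑ x ∈ a.support, a x * rep x : ℝ) : AddCircle L) = a.sum fun x n => n • x := by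
  rw [Finsupp.sum, ← QuotientAddGroup.mk'_apply, map_sum]
  refine Finset.sum_congr rfl fun x _ => ?_
  rw [← zsmul_eq_mul, map_zsmul, QuotientAddGroup.mk'_apply, coe_rep]

/-- `f` is piecewise linear on the circle, with divisor `a`. -/
def IsCircleDivisor (f : AddCircle L → ℝ) (a : AddCircle L →₀ ℤ) : Prop :=
  ∀ x, ∃ s t : ℤ, HasSlope (fun h => f (x + (h : AddCircle L))) s ∧
    HasSlope (fun h => f (x - (h : AddCircle L))) t ∧ a x = s + t

/-- Cutting the circle at 0 and subtracting the ramps of `a` leaves a function without break points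
on (0, L), hence affine. Comparing its slopes at the two ends gives the degree; comparing its values
gives the sum in the circle group. -/
theorem IsCircleDivisor.sum_eq_zero {f : AddCircle L → ℝ} {a : AddCircle L →₀ ℤ}
    (h : IsCircleDivisor f a) :
    (a.sum fun _ n => n) = 0 ∧ (a.sum fun x n => n • x) = 0 := by
  choose s t h1 h2 h3 using h
  have key := affine_of_slopes (ψ := fun y => f y + -rampSum a y) hL.out
    (fun y => s y + -∑ x ∈ a.support, a x * if rep x ≤ y then 1 else 0)
    (fun y => t y + -∑ x ∈ a.support, a x * if rep x < y then -1 else 0)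
    (fun y _ => HasSlope.add (by simpa using h1 y) (rampSum_right a y).neg)
    (fun y _ => HasSlope.add (by simpa using h2 y) (rampSum_left a y).neg)
    (fun y hy => by
      have := rampSum_slope_add a hy.1 hy.2
      have := h3 y
      linarith)
  obtain ⟨hv, hslope⟩ := key
  have hv := hv L ⟨hL.out.le, le_rfl⟩
  simp only [rampSum_slope_zero, rampSum_slope_end, rampSum_zero, rampSum_end] at hv hslope
  have hL0 : ((L : ℝ) : AddCircle L) = 0 := AddCircle.coe_period L
  have h00 : ((0 : ℝ) : AddCircle L) = 0 := rfl
  rw [hL0, h00] at hv hslope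
  have h30 := h3 0
  have hdeg : (a.sum fun _ n => n) = 0 := by linarith
  refine ⟨hdeg, ?_⟩
  rw [hdeg, h30] at hv
  push_cast at hv
  have : (∑ x ∈ a.support, a x * rep x : ℝ) = (-t 0 : ℤ) • L := by
    rw [zsmul_eq_mul]; push_cast; linarith
  rw [← coe_sum_rep, this, AddCircle.coe_zsmul, hL0, smul_zero]

theorem exists_isCircleDivisor (a : AddCircle L →₀ ℤ) (h0 : (a.sum fun _ n => n) = 0)
    (h1 : (a.sum fun x n => n • x) = 0) : ∃ f : AddCircle L → ℝ, IsCircleDivisor f a := by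
  rw [← coe_sum_rep] at h1
  obtain ⟨k, hk⟩ := (AddCircle.coe_eq_zero_iff L).1 h1
  rw [zsmul_eq_mul] at hk
  -- The slope `k` makes φ vanish at `L` as well as at 0, so that it descends to the circle; it is
  -- an integer because the sum of `a` vanishes in the circle group.
  let φ : ℝ → ℝ := fun y => k * y + rampSum a y
  have hφ0 : φ 0 = 0 := by simp [φ, rampSum_zero]
  have hφL : φ L = 0 := by simp [φ, rampSum_end, h0, hk]
  let f : AddCircle L → ℝ := fun x => φ (rep x)
  have hf : ∀ y ∈ Set.Icc 0 L, f y = φ y := by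
    intro y hy
    rcases hy.2.lt_or_eq with h | rfl
    · simp only [f, rep_coe hy.1 h]
    · have : ((y : ℝ) : AddCircle y) = ((0 : ℝ) : AddCircle y) := by simp
      simp only [f, this, rep_coe le_rfl hL.out, hφ0, hφL]
  have hright : ∀ y ∈ Set.Ico 0 L, HasSlope (fun h => f (y + h : ℝ))
      (k + ∑ x ∈ a.support, a x * if rep x ≤ y then 1 else 0) := by
    intro y hy
    have hk : HasSlope (fun h => (k : ℝ) * (y + h)) k := by
      refine Eventually.of_forall fun h => ?_; simp only []; ring
    refine (hk.add (rampSum_right a y)).congr ?_ (hf _ ⟨by linarith [hy.1], by linarith [hy.2]⟩)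
    filter_upwards [Ioo_mem_nhdsGT (sub_pos.2 hy.2)] with h hh
    exact hf _ ⟨by linarith [hy.1, hh.1], by linarith [hh.2]⟩
  have hleft : ∀ y ∈ Set.Ioc 0 L, HasSlope (fun h => f (y - h : ℝ))
      (-k + ∑ x ∈ a.support, a x * if rep x < y then -1 else 0) := by
    intro y hy
    have hk : HasSlope (fun h => (k : ℝ) * (y - h)) (-k) := by
      refine Eventually.of_forall fun h => ?_; push_cast; ring
    refine (hk.add (rampSum_left a y)).congr ?_ (hf _ ⟨by linarith [hy.1], by linarith [hy.2]⟩)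
    filter_upwards [Ioo_mem_nhdsGT hy.1] with h hh
    exact hf _ ⟨by linarith [hh.2], by linarith [hy.2, hh.1]⟩
  refine ⟨f, fun x => ?_⟩
  rcases (rep_nonneg x).lt_or_eq with h | h
  · have hr := hright (rep x) ⟨h.le, rep_lt x⟩
    have hl := hleft (rep x) ⟨h, (rep_lt x).le⟩
    simp only [AddCircle.coe_add, AddCircle.coe_sub, coe_rep] at hr hl
    refine ⟨_, _, hr, hl, ?_⟩
    have := rampSum_slope_add a h (rep_lt x)
    rw [coe_rep] at this
    linarith
  · have hx : x = 0 := by rw [← coe_rep x, ← h]; rfl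
    subst hx
    have hr := hright 0 ⟨le_rfl, hL.out⟩
    have hl := hleft L ⟨hL.out, le_rfl⟩
    simp only [AddCircle.coe_add, AddCircle.coe_sub, AddCircle.coe_period] at hr hl
    refine ⟨_, _, hr, hl, ?_⟩
    rw [rampSum_slope_zero, rampSum_slope_end, h0]
    ring

end Circle

/-- Clipping extends `f` to the real line, constantly outside [0, b]. The outer slopes are then
zero, so the slope changes in between add up to zero. -/
theorem interval_sum_eq_zero {b : ℝ} (hb : 0 ≤ b) (f : Set.Icc 0 b → ℝ) (c : Set.Icc 0 b →₀ ℤ)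
    (hc : ∀ x : Set.Icc 0 b, ∃ s t : ℤ,
      HasSlope (fun h => f (Set.projIcc 0 b hb (x + h))) s ∧
      HasSlope (fun h => f (Set.projIcc 0 b hb (x - h))) t ∧ c x = s + t) :
    (c.sum fun _ n => n) = 0 := by
  set F : ℝ → ℝ := fun y => f (Set.projIcc 0 b hb y) with hF
  have hR : ∀ y : ℝ, ∃ s t : ℤ, HasSlope (fun h => F (y + h)) s ∧ HasSlope (fun h => F (y - h)) t ∧
      (s + t = ∑ x ∈ c.support, c x * if (x : ℝ) = y then 1 else 0) ∧
      (y < 0 → s = 0) ∧ (b < y → t = 0) := by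
    intro y
    by_cases hy : y ∈ Set.Icc 0 b
    · obtain ⟨s, t, h1, h2, h3⟩ := hc ⟨y, hy⟩
      refine ⟨s, t, h1, h2, ?_, fun h => absurd hy.1 h.not_ge, fun h => absurd hy.2 h.not_ge⟩
      rw [← h3]
      have : ∀ x ∈ c.support, (c x * if (x : ℝ) = y then 1 else 0) = if x = ⟨y, hy⟩ then c x else 0 := by
        intro x _
        simp [Subtype.ext_iff]
      rw [Finset.sum_congr rfl this, Finset.sum_ite_eq']
      simp +contextual [eq_comm]
    · have h0 : (∑ x ∈ c.support, c x * if (x : ℝ) = y then 1 else 0) = 0 := by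
        refine Finset.sum_eq_zero fun x _ => ?_
        rw [if_neg (by rintro rfl; exact hy x.2), mul_zero]
      have hloc : ∀ᶠ z in 𝓝 y, F z = F y := by
        rcases not_and_or.1 hy with h | h
        · push Not at h
          filter_upwards [Iio_mem_nhds h] with z hz
          simp only [hF]
          rw [Set.projIcc_of_le_left hb (le_of_lt hz), Set.projIcc_of_le_left hb h.le]
        · push Not at h
          filter_upwards [Ioi_mem_nhds h] with z hz
          simp only [hF]
          rw [Set.projIcc_of_right_le hb (le_of_lt hz), Set.projIcc_of_right_le hb h.le]
      refine ⟨0, 0, ?_, ?_, by rw [h0, add_zero], fun _ => rfl, fun _ => rfl⟩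
      · rw [hasSlope_right_iff]
        filter_upwards [mem_nhdsWithin_of_mem_nhds hloc] with z hz
        rw [hz]; simp
      · rw [hasSlope_left_iff]
        filter_upwards [mem_nhdsWithin_of_mem_nhds hloc] with z hz
        rw [hz]; simp
  choose s t h1 h2 h3 h4 h5 using hR
  have key := affine_of_slopes (ψ := fun y => F y + -∑ x ∈ c.support, (c x : ℝ) * max (y - (x : ℝ)) 0)
    -- The larger interval puts both ends of the bridge in its interior and remains nondegenerate
    -- when `b = 0`.
    (show (-1 : ℝ) < b + 1 by linarith)
    (fun y => s y + -∑ x ∈ c.support, c x * if (x : ℝ) ≤ y then 1 else 0)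
    (fun y => t y + -∑ x ∈ c.support, c x * if (x : ℝ) < y then -1 else 0)
    (fun y _ => (h1 y).add
      (HasSlope.sum _ fun (x : Set.Icc 0 b) _ => (hasSlope_ramp_right (x : ℝ) y).const_mul (c x)).neg)
    (fun y _ => (h2 y).add
      (HasSlope.sum _ fun (x : Set.Icc 0 b) _ => (hasSlope_ramp_left (x : ℝ) y).const_mul (c x)).neg)
    (fun y _ => by
      have : ∀ x ∈ c.support, (c x * if (x : ℝ) = y then 1 else 0)
          = (c x * if (x : ℝ) ≤ y then 1 else 0) + (c x * if (x : ℝ) < y then -1 else 0) := by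
        intro x _
        rcases lt_trichotomy (x : ℝ) y with h | h | h
        · simp [h, h.le, h.ne]
        · simp [h]
        · simp [h.not_ge, h.not_gt, h.ne']
      have e := h3 y
      rw [Finset.sum_congr rfl this, Finset.sum_add_distrib] at e
      linarith)
  have hslope := key.2
  simp only [h4 (-1) (by norm_num), h5 (b + 1) (by linarith)] at hslope
  have e1 : (∑ x ∈ c.support, c x * if (x : ℝ) < b + 1 then -1 else 0) = -c.sum fun _ n => n := by
    rw [Finsupp.sum, ← Finset.sum_neg_distrib]
    refine Finset.sum_congr rfl fun x _ => ?_
    rw [if_pos (by linarith [x.2.2])]; ring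
  have e2 : (∑ x ∈ c.support, c x * if (x : ℝ) ≤ -1 then 1 else 0) = 0 := by
    refine Finset.sum_eq_zero fun x _ => ?_
    rw [if_neg (by linarith [x.2.1]), mul_zero]
  rw [e1, e2] at hslope
  linarith

end ChainOfLoops

/-! ### The Abel-Jacobi coordinates, and some principal divisors. -/

namespace ChainOfLoops
variable {g : ℕ} (Γ : ChainOfLoops g)

instance fact_length_pos (i : Fin g) : Fact (0 < Γ.ell i + Γ.m i) :=
  ⟨add_pos (Γ.ell_pos i) (Γ.m_pos i)⟩

/-- The `i`-th component of the Abel-Jacobi map, retracting the graph to the `i`-th loop. -/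
def aj (i : Fin g) : Γ.Point → Γ.Loop i :=
  Quot.lift
    (fun P => match P with
      | Sum.inl ⟨j, x⟩ => if h : j = i then h ▸ x else if j < i then 0 else Γ.mult i 1
      | Sum.inr ⟨k, _⟩ => if (k : ℕ) < i then 0 else Γ.mult i 1)
    (by
      rintro _ _ (k | k)
      · change (if (k : ℕ) < i then 0 else Γ.mult i 1)
          = if h : leftLoop k = i then h ▸ Γ.mult _ 1 else if leftLoop k < i then 0 else Γ.mult i 1
        by_cases h : leftLoop k = i
        · subst h
          simp [leftLoop]
        · rw [dif_neg h]
          rfl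
      · change (if (k : ℕ) < i then 0 else Γ.mult i 1)
          = if h : rightLoop k = i then h ▸ 0 else if rightLoop k < i then 0 else Γ.mult i 1
        by_cases h : rightLoop k = i
        · subst h
          rw [dif_pos rfl, if_pos (by simp [rightLoop])]
        · rw [dif_neg h]
          have h1 : (k : ℕ) + 1 ≠ i := fun h' => h (Fin.ext h')
          have h2 : rightLoop k < i ↔ (k : ℕ) < i := by
            rw [Fin.lt_def]; simp only [rightLoop]; omega
          simp only [h2])

@[simp] theorem aj_loopPt_self (i : Fin g) (x : Γ.Loop i) : Γ.aj i (Γ.loopPt i x) = x := by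
  change (if h : i = i then h ▸ x else _) = x
  rw [dif_pos rfl]

theorem aj_loopPt_of_lt {i j : Fin g} (h : j < i) (x : Γ.Loop j) : Γ.aj i (Γ.loopPt j x) = 0 := by
  change (if h : j = i then h ▸ x else if j < i then 0 else Γ.mult i 1) = 0
  rw [dif_neg h.ne, if_pos h]

theorem aj_loopPt_of_gt {i j : Fin g} (h : i < j) (x : Γ.Loop j) :
    Γ.aj i (Γ.loopPt j x) = Γ.mult i 1 := by
  change (if h : j = i then h ▸ x else if j < i then 0 else Γ.mult i 1) = _
  rw [dif_neg h.ne', if_neg h.not_gt]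

theorem aj_bridgePt (i : Fin g) (k : Fin (g - 1)) (t : Set.Icc (0 : ℝ) (Γ.b k)) :
    Γ.aj i (Γ.bridgePt k t) = if (k : ℕ) < i then 0 else Γ.mult i 1 := rfl

/-- The degree as a homomorphism. -/
def degHom : Γ.Divisor →+ ℤ := Finsupp.liftAddHom fun _ => AddMonoidHom.id ℤ

/-- The `i`-th component of the Abel-Jacobi map on divisors. -/
def abel (i : Fin g) : Γ.Divisor →+ Γ.Loop i :=
  Finsupp.liftAddHom fun P => zmultiplesHom _ (Γ.aj i P)

@[simp] theorem degHom_single (P : Γ.Point) (n : ℤ) : Γ.degHom (Finsupp.single P n) = n := by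
  simp [degHom]

@[simp] theorem abel_single (i : Fin g) (P : Γ.Point) (n : ℤ) :
    Γ.abel i (Finsupp.single P n) = n • Γ.aj i P := by
  simp [abel]

theorem degHom_mapDomain {α : Type} (u : α → Γ.Point) (e : α →₀ ℤ) :
    Γ.degHom (e.mapDomain u) = e.sum fun _ n => n := by
  simp only [degHom, Finsupp.liftAddHom_apply]
  rw [Finsupp.sum_mapDomain_index (by simp) (by simp)]
  rfl

theorem abel_mapDomain {α : Type} (i : Fin g) (u : α → Γ.Point) (e : α →₀ ℤ) :
    Γ.abel i (e.mapDomain u) = e.sum fun x n => n • Γ.aj i (u x) := by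
  simp only [abel, Finsupp.liftAddHom_apply]
  rw [Finsupp.sum_mapDomain_index (by simp) (by simp [add_smul])]
  simp

theorem sum_smul_const {α M : Type} [AddCommGroup M] (e : α →₀ ℤ) (v : M) :
    (e.sum fun _ n => n • v) = (e.sum fun _ n => n) • v := by
  simp [Finsupp.sum, Finset.sum_smul]

variable {Γ}

/-- Each loop and each bridge contributes degree zero separately. Any component other than loop `i`
retracts to a single point of loop `i`, so its contribution there is its degree times that point;
loop `i` itself contributes zero by `IsCircleDivisor.sum_eq_zero`. -/
theorem IsDivisorOf.degHom_eq_zero {f : Γ.Point → ℝ} {D : Γ.Divisor} (h : Γ.IsDivisorOf f D) :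
    Γ.degHom D = 0 ∧ ∀ i, Γ.abel i D = 0 := by
  obtain ⟨a, c, ha, hc, rfl⟩ := h
  have ha' := fun i => IsCircleDivisor.sum_eq_zero (f := fun x => f (Γ.loopPt i x)) (ha i)
  have hc' := fun i => interval_sum_eq_zero (Γ.b_nonneg i) (fun x => f (Γ.bridgePt i x)) (c i) (hc i)
  constructor
  · simp only [map_add, map_sum, degHom_mapDomain, hc', (ha' _).1]
    simp
  · intro i
    rw [map_add, map_sum, map_sum, Finset.sum_eq_zero, Finset.sum_eq_zero, add_zero]
    · intro k _
      simp only [abel_mapDomain, aj_bridgePt, sum_smul_const, hc', zero_smul]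
    · intro j _
      rw [abel_mapDomain]
      rcases lt_trichotomy j i with h | rfl | h
      · simp only [aj_loopPt_of_lt _ h, smul_zero]; simp
      · simpa using (ha' j).2
      · simp only [aj_loopPt_of_gt _ h, sum_smul_const, (ha' j).1, zero_smul]

/-- Pulling `f` back along the retraction to loop `i` makes it constant on every other component. -/
theorem IsCircleDivisor.mapDomain_mem {i : Fin g} {f : Γ.Loop i → ℝ} {a : Γ.Loop i →₀ ℤ}
    (h : IsCircleDivisor f a) : a.mapDomain (Γ.loopPt i) ∈ Γ.principal := by
  classical
  refine ⟨fun P => f (Γ.aj i P), Pi.single i a, 0, fun j x => ?_, fun k x => ?_, ?_⟩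
  · rcases lt_trichotomy j i with hj | rfl | hj
    · refine ⟨0, 0, ?_, ?_, by simp [hj.ne]⟩
      · simp only [aj_loopPt_of_lt _ hj]; exact hasSlope_const _
      · simp only [aj_loopPt_of_lt _ hj]; exact hasSlope_const _
    · simpa using h x
    · refine ⟨0, 0, ?_, ?_, by simp [hj.ne']⟩
      · simp only [aj_loopPt_of_gt _ hj]; exact hasSlope_const _
      · simp only [aj_loopPt_of_gt _ hj]; exact hasSlope_const _
  · refine ⟨0, 0, ?_, ?_, by simp⟩
    · simp only [bridgeClip, aj_bridgePt]; exact hasSlope_const _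
    · simp only [bridgeClip, aj_bridgePt]; exact hasSlope_const _
  · rw [Finset.sum_eq_single i, Finset.sum_eq_zero]
    · simp
    · simp
    · intro j _ hj
      simp [hj]
    · simp

variable (Γ)

/-- The position along the `k`-th bridge, retracting the graph to this bridge. -/
def bridgePos (k : Fin (g - 1)) : Γ.Point → ℝ :=
  Quot.lift
    (fun P => match P with
      | Sum.inl ⟨j, _⟩ => if (j : ℕ) ≤ k then 0 else Γ.b k
      | Sum.inr ⟨j, u⟩ => if j < k then 0 else if j = k then u else Γ.b k)
    (by
      rintro _ _ (j | j)
      · change (if j < k then 0 else if j = k then 0 else Γ.b k) = if (j : ℕ) ≤ k then 0 else Γ.b k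
        rcases lt_trichotomy j k with h | h | h
        · rw [if_pos h, if_pos (by exact h.le)]
        · simp [h]
        · rw [if_neg h.not_gt, if_neg h.ne', if_neg (by exact h.not_ge)]
      · change (if j < k then 0 else if j = k then Γ.b j else Γ.b k)
          = if (j : ℕ) + 1 ≤ k then 0 else Γ.b k
        rcases lt_trichotomy j k with h | h | h
        · rw [if_pos h, if_pos (by exact h)]
        · simp [h]
        · rw [if_neg h.not_gt, if_neg h.ne', if_neg (by have : (k : ℕ) < j := h; omega)])

theorem bridgePos_loopPt (k : Fin (g - 1)) (j : Fin g) (x : Γ.Loop j) :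
    Γ.bridgePos k (Γ.loopPt j x) = if (j : ℕ) ≤ k then 0 else Γ.b k := rfl

theorem bridgePos_bridgePt (k j : Fin (g - 1)) (u : Set.Icc (0 : ℝ) (Γ.b j)) :
    Γ.bridgePos k (Γ.bridgePt j u) = if j < k then 0 else if j = k then (u : ℝ) else Γ.b k := rfl

theorem bridge_mem_principal (k : Fin (g - 1)) (t : Set.Icc (0 : ℝ) (Γ.b k)) :
    Finsupp.single (Γ.bridgePt k ⟨0, le_rfl, Γ.b_nonneg k⟩) 1 - Finsupp.single (Γ.bridgePt k t) 1
      ∈ Γ.principal := by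
  classical
  set c : Set.Icc (0 : ℝ) (Γ.b k) →₀ ℤ :=
    Finsupp.single ⟨0, le_rfl, Γ.b_nonneg k⟩ 1 - Finsupp.single t 1 with hc
  -- This function rises with slope 1 from the left end of the bridge to `t` and is constant
  -- elsewhere. For a bridge or a `t` of length zero it is constant and both sides vanish.
  refine ⟨fun P => min (Γ.bridgePos k P) t, 0, Pi.single k c, fun j x => ?_, fun j x => ?_, ?_⟩
  · refine ⟨0, 0, ?_, ?_, by simp⟩
    · simp only [bridgePos_loopPt]; exact hasSlope_const _
    · simp only [bridgePos_loopPt]; exact hasSlope_const _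
  · by_cases hj : j = k
    · subst hj
      obtain ⟨x, hx0, hx1⟩ := x
      obtain ⟨t, ht0, ht1⟩ := t
      have hcx : c ⟨x, hx0, hx1⟩ = (if x = 0 then 1 else 0) - (if x = t then 1 else 0) := by
        rw [hc, Finsupp.sub_apply, Finsupp.single_apply, Finsupp.single_apply]
        congr 1
        · refine if_congr ⟨fun h => (Subtype.mk.inj h).symm, fun h => Subtype.ext h.symm⟩ rfl rfl
        · refine if_congr ⟨fun h => (Subtype.mk.inj h).symm, fun h => Subtype.ext h.symm⟩ rfl rfl
      simp only [bridgeClip, bridgePos_bridgePt, lt_irrefl, if_false, if_true, Pi.single_eq_same, hcx]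
      refine ⟨if x < t then 1 else 0, if 0 < x ∧ x ≤ t then -1 else 0, ?_, ?_, ?_⟩
      · rw [hasSlope_right_iff
          (ψ := fun y => min (Set.projIcc 0 (Γ.b j) (Γ.b_nonneg j) y : ℝ) t)]
        have px : (Set.projIcc 0 (Γ.b j) (Γ.b_nonneg j) x : ℝ) = x := by
          rw [Set.projIcc_of_mem _ ⟨hx0, hx1⟩]
        split_ifs with h
        · filter_upwards [Ioo_mem_nhdsGT h] with y hy
          rw [Set.projIcc_of_mem _ ⟨hx0.trans hy.1.le, hy.2.le.trans ht1⟩, px, min_eq_left hy.2.le,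
            min_eq_left h.le]
          push_cast; ring
        · push Not at h
          filter_upwards [self_mem_nhdsWithin] with y hy
          have hy : x < y := hy
          have : t ≤ Set.projIcc 0 (Γ.b j) (Γ.b_nonneg j) y := by
            have := Set.monotone_projIcc (Γ.b_nonneg j) hy.le
            have : (Set.projIcc 0 (Γ.b j) (Γ.b_nonneg j) x : ℝ) ≤
              Set.projIcc 0 (Γ.b j) (Γ.b_nonneg j) y := this
            linarith
          rw [px, min_eq_right this, min_eq_right h]
          simp
      · rw [hasSlope_left_iff
          (ψ := fun y => min (Set.projIcc 0 (Γ.b j) (Γ.b_nonneg j) y : ℝ) t)]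
        have px : (Set.projIcc 0 (Γ.b j) (Γ.b_nonneg j) x : ℝ) = x := by
          rw [Set.projIcc_of_mem _ ⟨hx0, hx1⟩]
        split_ifs with h
        · filter_upwards [Ioo_mem_nhdsLT h.1] with y hy
          rw [Set.projIcc_of_mem _ ⟨hy.1.le, hy.2.le.trans hx1⟩, px, min_eq_left (hy.2.le.trans h.2),
            min_eq_left h.2]
          push_cast; ring
        · rcases hx0.lt_or_eq with h0 | rfl
          · have h : t < x := by
              by_contra h'
              exact h ⟨h0, not_lt.1 h'⟩
            filter_upwards [Ioo_mem_nhdsLT (max_lt h h0)] with y hy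
            have h1 := (le_max_left _ _).trans_lt hy.1
            have h2 := (le_max_right _ _).trans_lt hy.1
            rw [Set.projIcc_of_mem _ ⟨h2.le, hy.2.le.trans hx1⟩, px, min_eq_right h1.le,
              min_eq_right h.le]
            simp
          · filter_upwards [self_mem_nhdsWithin] with y hy
            rw [Set.projIcc_of_le_left _ (le_of_lt hy), px]
            simp
      · rcases lt_trichotomy x t with h | rfl | h
        · rcases hx0.lt_or_eq with h0 | rfl
          · simp [h, h0, h0.ne', h.ne, h.le]
          · simp [h, h.ne]
        · rcases hx0.lt_or_eq with h0 | rfl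
          · simp [h0, h0.ne']
          · simp
        · simp [h.not_gt, h.not_ge, h.ne', (ht0.trans_lt h).ne']
    · refine ⟨0, 0, ?_, ?_, by simp [hj]⟩
      · simp only [bridgeClip, bridgePos_bridgePt, if_neg hj]; exact hasSlope_const _
      · simp only [bridgeClip, bridgePos_bridgePt, if_neg hj]; exact hasSlope_const _
  · rw [Finset.sum_eq_zero, Finset.sum_eq_single k]
    · have key : ∀ {α β : Type} (u : α → β) (e e' : α →₀ ℤ),
          (e - e').mapDomain u = e.mapDomain u - e'.mapDomain u := fun u e e' =>
        map_sub (Finsupp.mapDomain.addMonoidHom u) e e'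
      simp [hc, key, Finsupp.mapDomain_single]
    · intro j _ hj
      simp [hj]
    · simp
    · simp

end ChainOfLoops

/-! ### The Abel-Jacobi theorem, multiples of `m i`, and a criterion for effectivity. -/

namespace ChainOfLoops
variable {g : ℕ} (Γ : ChainOfLoops g)

variable {Γ} in
theorem cls_eq_cls {D D' : Γ.Divisor} : cls D = cls D' ↔ D - D' ∈ Γ.principal := by
  rw [cls, cls, QuotientAddGroup.eq, ← neg_mem_iff, neg_add_rev, neg_neg, sub_eq_neg_add, neg_add_eq_sub,
    sub_eq_neg_add]

variable {Γ} in
@[simp] theorem cls_add (D D' : Γ.Divisor) : cls (D + D') = cls D + cls D' := rfl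

variable {Γ} in
@[simp] theorem cls_sub (D D' : Γ.Divisor) : cls (D - D') = cls D - cls D' := rfl

/-- The class of `x - v i` on the `i`-th loop depends additively on `x`. -/
def loopCls (i : Fin g) : Γ.Loop i →+ Γ.Pic :=
  AddMonoidHom.mk'
    (fun x => cls (Finsupp.single (Γ.loopPt i x) 1 - Finsupp.single (Γ.v i) 1))
    (fun x y => by
      rw [← cls_add, cls_eq_cls]
      let a : Γ.Loop i →₀ ℤ := Finsupp.single (x + y) 1 + Finsupp.single 0 1
        - (Finsupp.single x 1 + Finsupp.single y 1)
      have h0 : (a.sum fun _ n => n) = 0 := by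
        change Finsupp.liftAddHom (fun _ => AddMonoidHom.id ℤ) a = 0
        simp only [a, map_sub, map_add, Finsupp.liftAddHom_apply_single]
        simp
      have h1 : (a.sum fun x n => n • x) = 0 := by
        change Finsupp.liftAddHom (fun x => zmultiplesHom (Γ.Loop i) x) a = 0
        simp only [a, map_sub, map_add, Finsupp.liftAddHom_apply_single]
        simp
      obtain ⟨f, hf⟩ := exists_isCircleDivisor a h0 h1
      have key : a.mapDomain (Γ.loopPt i) = Finsupp.single (Γ.loopPt i (x + y)) 1
          + Finsupp.single (Γ.v i) 1
          - (Finsupp.single (Γ.loopPt i x) 1 + Finsupp.single (Γ.loopPt i y) 1) := by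
        change Finsupp.mapDomain.addMonoidHom (Γ.loopPt i) a = _
        simp only [a, map_sub, map_add, Finsupp.mapDomain.addMonoidHom_apply,
          Finsupp.mapDomain_single]
        rfl
      have := hf.mapDomain_mem
      rw [key] at this
      convert this using 1
      abel)

theorem cls_loopPt (i : Fin g) (x : Γ.Loop i) :
    cls (Finsupp.single (Γ.loopPt i x) 1) = cls (Finsupp.single (Γ.v i) 1) + Γ.loopCls i x := by
  simp [loopCls]

theorem bridgePt_zero (k : Fin (g - 1)) :
    Γ.bridgePt k ⟨0, le_rfl, Γ.b_nonneg k⟩ = Γ.loopPt (leftLoop k) (Γ.mult _ 1) :=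
  Quot.sound (Glue.left k)

theorem bridgePt_end (k : Fin (g - 1)) :
    Γ.bridgePt k ⟨Γ.b k, Γ.b_nonneg k, le_rfl⟩ = Γ.v (rightLoop k) :=
  Quot.sound (Glue.right k)

theorem cls_bridgePt (k : Fin (g - 1)) (t : Set.Icc (0 : ℝ) (Γ.b k)) :
    cls (Finsupp.single (Γ.bridgePt k t) 1)
      = cls (Finsupp.single (Γ.loopPt (leftLoop k) (Γ.mult _ 1)) 1) := by
  rw [← bridgePt_zero]
  exact (cls_eq_cls.2 (Γ.bridge_mem_principal k t)).symm

theorem cls_v (n : ℕ) (hn : n < g) : cls (Finsupp.single (Γ.v ⟨n, hn⟩) 1)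
    = cls (Finsupp.single Γ.v₁ 1)
      + ∑ i : Fin g, if (i : ℕ) < n then Γ.loopCls i (Γ.mult i 1) else 0 := by
  induction n with
  | zero => simp [v₁]
  | succ n ih =>
    have hn' : n < g := by omega
    have e1 := Γ.bridgePt_end ⟨n, by omega⟩
    change _ = Γ.v ⟨n + 1, hn⟩ at e1
    rw [← e1, cls_bridgePt]
    change cls (Finsupp.single (Γ.loopPt ⟨n, hn'⟩ (Γ.mult _ 1)) 1) = _
    rw [cls_loopPt, ih hn', add_assoc]
    congr 1
    have : Γ.loopCls ⟨n, hn'⟩ (Γ.mult ⟨n, hn'⟩ 1)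
        = ∑ i : Fin g, if i = ⟨n, hn'⟩ then Γ.loopCls i (Γ.mult i 1) else 0 := by simp
    rw [this, ← Finset.sum_add_distrib]
    refine Finset.sum_congr rfl fun i _ => ?_
    have hi : i = ⟨n, hn'⟩ ↔ (i : ℕ) = n := Fin.ext_iff
    simp only [hi]
    rcases lt_trichotomy (i : ℕ) n with h | h | h
    · simp [h, h.ne, h.trans n.lt_succ_self]
    · simp [h]
    · simp [h.ne', h.not_gt, (Nat.succ_le_of_lt h).not_gt]

theorem cls_point (j : Fin g) (x : Γ.Loop j) (P : Γ.Point)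
    (hP : cls (Finsupp.single P 1) = cls (Finsupp.single (Γ.loopPt j x) 1))
    (haj : ∀ i, Γ.aj i P = Γ.aj i (Γ.loopPt j x)) :
    cls (Finsupp.single P 1) = cls (Finsupp.single Γ.v₁ 1) + ∑ i, Γ.loopCls i (Γ.aj i P) := by
  rw [hP, cls_loopPt, Γ.cls_v j j.2, add_assoc]
  congr 1
  have : Γ.loopCls j x = ∑ i : Fin g, if i = j then Γ.loopCls i (Γ.aj i P) else 0 := by simp [haj]
  rw [this, ← Finset.sum_add_distrib]
  refine Finset.sum_congr rfl fun i _ => ?_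
  rw [haj]
  rcases lt_trichotomy i j with h | rfl | h
  · rw [if_pos (by exact h), if_neg h.ne, aj_loopPt_of_gt _ h, add_zero]
  · simp
  · rw [if_neg (by exact h.not_gt), if_neg h.ne', aj_loopPt_of_lt _ h]
    simp

theorem aj_bridgePt_eq (i : Fin g) (k : Fin (g - 1)) (t : Set.Icc (0 : ℝ) (Γ.b k)) :
    Γ.aj i (Γ.bridgePt k t) = Γ.aj i (Γ.loopPt (leftLoop k) (Γ.mult _ 1)) := by
  rw [← bridgePt_zero]
  rfl

/-- Every point is equivalent to a point of a loop. -/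
theorem exists_loopPt (P : Γ.Point) : ∃ y : Σ j : Fin g, Γ.Loop j,
    cls (Finsupp.single P 1) = cls (Finsupp.single (Γ.loopPt y.1 y.2) 1) ∧
    ∀ i, Γ.aj i P = Γ.aj i (Γ.loopPt y.1 y.2) := by
  induction P using Quot.ind with
  | mk P =>
    rcases P with ⟨j, x⟩ | ⟨k, t⟩
    · exact ⟨⟨j, x⟩, rfl, fun _ => rfl⟩
    · exact ⟨⟨leftLoop k, Γ.mult _ 1⟩, Γ.cls_bridgePt k t, fun i => Γ.aj_bridgePt_eq i k t⟩

/-- The class is recovered from the degree and the coordinates, which is the injectivity in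
`cls_eq_iff`. By additivity it suffices to check single points. -/
theorem cls_eq_sum (D : Γ.Divisor) : cls D = zmultiplesHom Γ.Pic (cls (Finsupp.single Γ.v₁ 1))
    (Γ.degHom D) + ∑ i, Γ.loopCls i (Γ.abel i D) := by
  have key : QuotientAddGroup.mk' Γ.principal
      = (zmultiplesHom Γ.Pic (cls (Finsupp.single Γ.v₁ 1))).comp Γ.degHom
        + ∑ i, (Γ.loopCls i).comp (Γ.abel i) := by
    refine Finsupp.addHom_ext' fun P => AddMonoidHom.ext_int ?_
    obtain ⟨y, h1, h2⟩ := Γ.exists_loopPt P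
    simpa [cls] using Γ.cls_point y.1 y.2 P h1 h2
  simpa [cls] using DFunLike.congr_fun key D

variable {Γ} in
/-- The Abel-Jacobi theorem for a chain of loops. -/
theorem cls_eq_iff {D D' : Γ.Divisor} :
    cls D = cls D' ↔ Γ.degHom D = Γ.degHom D' ∧ ∀ i, Γ.abel i D = Γ.abel i D' := by
  constructor
  · intro h
    obtain ⟨f, hf⟩ := cls_eq_cls.1 h
    obtain ⟨h1, h2⟩ := hf.degHom_eq_zero
    simp only [map_sub, sub_eq_zero] at h1 h2
    exact ⟨h1, h2⟩
  · rintro ⟨h1, h2⟩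
    rw [cls_eq_sum, cls_eq_sum _ D', h1]
    simp only [h2]

/-! Multiples of `m i`. -/

theorem mult_add (i : Fin g) (k l : ℤ) : Γ.mult i (k + l) = Γ.mult i k + Γ.mult i l := by
  simp [mult, add_mul]

@[simp] theorem mult_zero (i : Fin g) : Γ.mult i 0 = 0 := by simp [mult]

theorem mult_sub (i : Fin g) (k l : ℤ) : Γ.mult i (k - l) = Γ.mult i k - Γ.mult i l := by
  simp [mult, sub_mul]

theorem smul_mult_one (i : Fin g) (n : ℤ) : n • Γ.mult i 1 = Γ.mult i n := by
  simp only [mult, ← AddCircle.coe_zsmul, zsmul_eq_mul]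
  simp

theorem mult_one_ne_zero (i : Fin g) : Γ.mult i 1 ≠ 0 := by
  intro h
  rw [mult, AddCircle.coe_eq_zero_iff] at h
  obtain ⟨n, hn⟩ := h
  rw [zsmul_eq_mul] at hn
  push_cast at hn
  have h1 := Γ.ell_pos i
  have h2 := Γ.m_pos i
  have h3 : 0 < n := by
    by_contra h
    have : (n : ℝ) ≤ 0 := by exact_mod_cast not_lt.1 h
    nlinarith
  have h4 : (1 : ℝ) ≤ n := by exact_mod_cast h3
  nlinarith

variable {Γ} in
theorem IsGeneric.mult_ne_zero (hΓ : Γ.IsGeneric) (i : Fin g) {k : ℤ} (h0 : 0 < k)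
    (hk : k ≤ 2 * g - 2) : Γ.mult i k ≠ 0 := by
  intro h
  rw [mult, AddCircle.coe_eq_zero_iff] at h
  obtain ⟨n, hn⟩ := h
  rw [zsmul_eq_mul] at hn
  have h1 := Γ.ell_pos i
  have h2 := Γ.m_pos i
  have hk' : (0 : ℝ) < k := by exact_mod_cast h0
  have h3 : 0 < n := by
    by_contra h
    have : (n : ℝ) ≤ 0 := by exact_mod_cast not_lt.1 h
    nlinarith [mul_pos hk' h2]
  have h3' : (0 : ℝ) < n := by exact_mod_cast h3
  have h4 : n < k := by
    by_contra h
    have : (k : ℝ) ≤ n := by exact_mod_cast not_lt.1 h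
    nlinarith [mul_pos h3' h1]
  -- The relation k m = n (ℓ + m) reads ℓ/m = (k - n)/n, and these two positive integers have sum k.
  refine hΓ i (k - n).toNat n.toNat (by omega) (by omega) (by omega) ?_
  have e1 : (((k - n).toNat : ℕ) : ℝ) = k - n := by
    have : (((k - n).toNat : ℕ) : ℤ) = k - n := Int.toNat_of_nonneg (by omega)
    exact_mod_cast congrArg (Int.cast : ℤ → ℝ) this
  have e2 : ((n.toNat : ℕ) : ℝ) = n := by
    have : ((n.toNat : ℕ) : ℤ) = n := Int.toNat_of_nonneg (by omega)
    exact_mod_cast congrArg (Int.cast : ℤ → ℝ) this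
  rw [e1, e2, div_eq_div_iff h2.ne' h3'.ne']
  linarith

variable {Γ} in
theorem IsGeneric.mult_injective (hΓ : Γ.IsGeneric) (i : Fin g) {k l : ℤ}
    (h1 : k - l ≤ 2 * g - 2) (h2 : l - k ≤ 2 * g - 2) (h : Γ.mult i k = Γ.mult i l) : k = l := by
  rcases lt_trichotomy k l with h' | h' | h'
  · exact absurd (by rw [mult_sub, h, sub_self]) (hΓ.mult_ne_zero i (sub_pos.2 h') h2)
  · exact h'
  · exact absurd (by rw [mult_sub, h, sub_self]) (hΓ.mult_ne_zero i (sub_pos.2 h') h1)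

/-! Effective classes. -/

/-- A loop and a coordinate on it, representing the point up to equivalence. -/
def loopRep (P : Γ.Point) : Σ j : Fin g, Γ.Loop j := (Γ.exists_loopPt P).choose

theorem aj_loopRep (i : Fin g) (P : Γ.Point) :
    Γ.aj i P = Γ.aj i (Γ.loopPt (Γ.loopRep P).1 (Γ.loopRep P).2) :=
  (Γ.exists_loopPt P).choose_spec.2 i

/-- The number of chips on the loops from the `i`-th on. -/
def chipsFrom (i : ℕ) : Γ.Divisor →+ ℤ :=
  Finsupp.liftAddHom fun P => if i ≤ (Γ.loopRep P).1 then AddMonoidHom.id ℤ else 0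

theorem chipsFrom_apply (i : ℕ) (D : Γ.Divisor) :
    Γ.chipsFrom i D = ∑ P ∈ D.support, if i ≤ (Γ.loopRep P).1 then D P else 0 := by
  rw [chipsFrom, Finsupp.liftAddHom_apply, Finsupp.sum]
  refine Finset.sum_congr rfl fun P _ => ?_
  split_ifs <;> rfl

theorem chipsFrom_zero (D : Γ.Divisor) : Γ.chipsFrom 0 D = Γ.degHom D := by
  simp [chipsFrom, degHom]

theorem chipsFrom_genus (D : Γ.Divisor) : Γ.chipsFrom g D = 0 := by
  rw [chipsFrom_apply]
  refine Finset.sum_eq_zero fun P _ => if_neg ?_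
  have := (Γ.loopRep P).1.2
  omega

variable {Γ} in
theorem chipsFrom_succ_le {D : Γ.Divisor} (hD : 0 ≤ D) (i : ℕ) :
    Γ.chipsFrom (i + 1) D ≤ Γ.chipsFrom i D := by
  rw [chipsFrom_apply, chipsFrom_apply]
  refine Finset.sum_le_sum fun P _ => ?_
  have := hD P
  simp only [Finsupp.coe_zero, Pi.zero_apply] at this
  split_ifs <;> omega

-- Equal counts mean that no chip is assigned to loop `i`: chips further left retract to 0 and chips
-- further right to `w i`. The choice in `loopRep` assigns each point to one loop, also when it is a
-- shared vertex.
variable {Γ} in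
theorem abel_of_chipsFrom_eq {D : Γ.Divisor} (hD : 0 ≤ D) (i : Fin g)
    (h : Γ.chipsFrom (i + 1) D = Γ.chipsFrom i D) :
    Γ.abel i D = Γ.mult i (Γ.chipsFrom (i + 1) D) := by
  rw [← smul_mult_one, chipsFrom_apply, Finset.sum_smul, abel, Finsupp.liftAddHom_apply, Finsupp.sum]
  refine Finset.sum_congr rfl fun P hP => ?_
  simp only [zmultiplesHom_apply]
  rcases lt_trichotomy (Γ.loopRep P).1 i with h' | h' | h'
  · rw [aj_loopRep, aj_loopPt_of_lt _ h', smul_zero, if_neg, zero_smul]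
    have : ((Γ.loopRep P).1 : ℕ) < i := h'
    omega
  · have : D P = 0 := by
      rw [chipsFrom_apply, chipsFrom_apply] at h
      have := (Finset.sum_eq_sum_iff_of_le (fun P _ => ?_)).1 h P hP
      · rwa [if_neg (by rw [h']; omega), if_pos (by rw [h']), eq_comm] at this
      · have := hD P
        simp only [Finsupp.coe_zero, Pi.zero_apply] at this
        split_ifs <;> omega
    simp [this]
  · rw [aj_loopRep, aj_loopPt_of_gt _ h', if_pos]
    exact h'

open Classical in
/-- The number of chips of a class with Abel-Jacobi image `u` and degree `d` that can be moved
to the right of the first `i` loops. -/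
def leftWalk (u : ∀ i, Γ.Loop i) (d : ℤ) : ℕ → ℤ
  | 0 => d
  | i + 1 => if ∃ h : i < g, u ⟨i, h⟩ ≠ Γ.mult ⟨i, h⟩ (leftWalk u d i) then leftWalk u d i - 1
      else leftWalk u d i

variable {Γ}

@[simp] theorem leftWalk_zero (u : ∀ i, Γ.Loop i) (d : ℤ) : Γ.leftWalk u d 0 = d := rfl

theorem leftWalk_hit {u : ∀ i, Γ.Loop i} {d : ℤ} {i : Fin g}
    (h : u i = Γ.mult i (Γ.leftWalk u d i)) : Γ.leftWalk u d (i + 1) = Γ.leftWalk u d i := by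
  rw [leftWalk, if_neg]
  rintro ⟨h', h''⟩
  exact h'' h

theorem leftWalk_miss {u : ∀ i, Γ.Loop i} {d : ℤ} {i : Fin g}
    (h : u i ≠ Γ.mult i (Γ.leftWalk u d i)) : Γ.leftWalk u d (i + 1) = Γ.leftWalk u d i - 1 := by
  rw [leftWalk, if_pos]
  exact ⟨i.2, h⟩

theorem leftWalk_le (u : ∀ i, Γ.Loop i) (d : ℤ) (i : ℕ) :
    Γ.leftWalk u d (i + 1) ≤ Γ.leftWalk u d i := by
  rw [leftWalk]; split_ifs <;> omega

theorem sub_one_le_leftWalk (u : ∀ i, Γ.Loop i) (d : ℤ) (i : ℕ) :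
    Γ.leftWalk u d i - 1 ≤ Γ.leftWalk u d (i + 1) := by
  rw [leftWalk]; split_ifs <;> omega

/-- The bound could fail only on a loop where the two counts agree, no chip is assigned to the loop,
and the walk drops. But without a chip on the loop its coordinate is the carried count times `m i`,
so the walk does not drop. -/
theorem chipsFrom_le_leftWalk {D : Γ.Divisor} (hD : 0 ≤ D) (i : ℕ) (hi : i ≤ g) :
    Γ.chipsFrom i D ≤ Γ.leftWalk (fun j => Γ.abel j D) (Γ.degHom D) i := by
  induction i with
  | zero => rw [chipsFrom_zero, leftWalk_zero]
  | succ i ih =>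
    have ih := ih (by omega)
    have h1 := chipsFrom_succ_le hD i
    have h2 := sub_one_le_leftWalk (fun j => Γ.abel j D) (Γ.degHom D) i
    by_contra hlt
    have h3 : Γ.chipsFrom (i + 1) D = Γ.chipsFrom i D := by omega
    have h4 : Γ.leftWalk (fun j => Γ.abel j D) (Γ.degHom D) i = Γ.chipsFrom i D := by omega
    have h5 := abel_of_chipsFrom_eq hD ⟨i, hi⟩ h3
    have h6 := leftWalk_hit (u := fun j => Γ.abel j D) (d := Γ.degHom D) (i := ⟨i, hi⟩)
      (by simp only [h5, h4]; exact congrArg _ h3)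
    simp only at h6
    omega

theorem sum_telescope_from (k : ℕ → ℤ) (j : Fin g) :
    ∑ i : Fin g, (if j < i then k i - k (i + 1) else 0) = k (j + 1) - k g := by
  have : ∀ n, (j : ℕ) + 1 ≤ n →
      ∑ i ∈ Finset.range n, (if (j : ℕ) < i then k i - k (i + 1) else 0) = k (j + 1) - k n := by
    intro n hn
    induction n, hn using Nat.le_induction with
    | base =>
      rw [sub_self]
      refine Finset.sum_eq_zero fun i hi => if_neg ?_
      have := Finset.mem_range.1 hi
      omega
    | succ n hn ih =>
      rw [Finset.sum_range_succ, ih, if_pos (by omega)]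
      ring
  rw [← this g j.2, ← Fin.sum_univ_eq_sum_range fun i => if (j : ℕ) < i then k i - k (i + 1) else 0]
  rfl

theorem exists_effective {u : ∀ i, Γ.Loop i} {d : ℤ} (h : 0 ≤ Γ.leftWalk u d g) :
    ∃ D : Γ.Divisor, 0 ≤ D ∧ Γ.degHom D = d ∧ ∀ i, Γ.abel i D = u i := by
  set k := Γ.leftWalk u d with hk
  let last : Fin g := ⟨g - 1, by have := Γ.genus_pos; omega⟩
  -- The chip lost on loop `i`, if any, is placed where it corrects the coordinate there; the
  -- remaining `k g` chips go to the rightmost vertex.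
  refine ⟨Finsupp.single (Γ.loopPt last (Γ.mult last 1)) (k g)
    + ∑ i : Fin g, Finsupp.single (Γ.loopPt i (u i - Γ.mult i (k (i + 1)))) (k i - k (i + 1)),
    ?_, ?_, fun j => ?_⟩
  · refine add_nonneg (Finsupp.single_nonneg.2 h) (Finset.sum_nonneg fun i _ => ?_)
    exact Finsupp.single_nonneg.2 (sub_nonneg.2 (leftWalk_le u d i))
  · simp only [map_add, map_sum, degHom_single]
    rw [Fin.sum_univ_eq_sum_range fun i => k i - k (i + 1), Finset.sum_range_sub']
    simp [hk]
  · simp only [map_add, map_sum, abel_single]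
    have hlast : Γ.aj j (Γ.loopPt last (Γ.mult last 1)) = Γ.mult j 1 := by
      have : j ≤ last := Fin.le_def.2 (by simp only [last]; omega)
      rcases this.lt_or_eq with h | rfl
      · exact aj_loopPt_of_gt _ h _
      · exact aj_loopPt_self _ _ _
    have hterm : ∀ i : Fin g, (k i - k (i + 1)) • Γ.aj j (Γ.loopPt i (u i - Γ.mult i (k (i + 1))))
        = (if j < i then k i - k (i + 1) else 0) • Γ.mult j 1
          + if i = j then (k j - k (j + 1)) • (u j - Γ.mult j (k (j + 1))) else 0 := by
      intro i
      rcases lt_trichotomy i j with h | rfl | h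
      · simp [aj_loopPt_of_lt _ h, h.not_gt, h.ne]
      · simp
      · simp [aj_loopPt_of_gt _ h, h, h.ne']
    rw [Finset.sum_congr rfl fun i _ => hterm i, Finset.sum_add_distrib, ← Finset.sum_smul,
      sum_telescope_from, Finset.sum_ite_eq', if_pos (Finset.mem_univ _), hlast, smul_mult_one,
      smul_mult_one, ← add_assoc, ← mult_add, add_sub_cancel]
    by_cases hj : u j = Γ.mult j (k j)
    · have := leftWalk_hit hj
      rw [← hk] at this
      rw [this, sub_self, zero_smul, add_zero, hj]
    · have := leftWalk_miss hj
      rw [← hk] at this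
      rw [this, sub_sub_cancel, one_smul, add_sub_cancel]

/-- A class contains an effective divisor if and only if enough chips can be moved to the right. -/
theorem exists_effective_iff {D : Γ.Divisor} :
    (∃ D' : Γ.Divisor, 0 ≤ D' ∧ cls D' = cls D) ↔
      0 ≤ Γ.leftWalk (fun i => Γ.abel i D) (Γ.degHom D) g := by
  constructor
  · rintro ⟨D', h, h'⟩
    obtain ⟨h1, h2⟩ := cls_eq_iff.1 h'
    have := chipsFrom_le_leftWalk h g le_rfl
    rw [chipsFrom_genus, h1] at this
    simpa only [h2] using this
  · intro h
    obtain ⟨D', h1, h2, h3⟩ := exists_effective h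
    exact ⟨D', h1, cls_eq_iff.2 ⟨h2, h3⟩⟩

end ChainOfLoops

/-! ### Counting loops, coordinates of reduced divisors, and estimates for the walk. -/

namespace ChainOfLoops
variable {g : ℕ} {Γ : ChainOfLoops g}

theorem backward_induction {q : ℕ → Prop} (h0 : q g) (h : ∀ i : Fin g, q (i + 1) → q i) :
    ∀ i ≤ g, q i := fun _ hi =>
  Nat.decreasingInduction (motive := fun i _ => q i) (fun _ hi => h ⟨_, hi⟩) h0 hi

open Classical in
/-- The number of loops with property `q` from the `i`-th on. -/
def countFrom (q : Fin g → Prop) (i : ℕ) : ℤ := (Finset.univ.filter fun j : Fin g => i ≤ j ∧ q j).card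

theorem countFrom_genus (q : Fin g → Prop) : countFrom q g = 0 := by
  classical
  rw [countFrom, Finset.filter_false_of_mem]
  · simp
  · rintro j - ⟨h, -⟩
    have := j.2
    omega

theorem countFrom_of_mem {q : Fin g → Prop} {i : Fin g} (h : q i) :
    countFrom q i = countFrom q (i + 1) + 1 := by
  classical
  have : (Finset.univ.filter fun j : Fin g => (i : ℕ) ≤ j ∧ q j)
      = insert i (Finset.univ.filter fun j : Fin g => (i : ℕ) + 1 ≤ j ∧ q j) := by
    ext j
    simp only [Finset.mem_filter, Finset.mem_univ, true_and, Finset.mem_insert, Fin.ext_iff]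
    constructor
    · rintro ⟨h1, h2⟩
      by_cases h3 : (j : ℕ) = i
      · exact Or.inl h3
      · exact Or.inr ⟨by omega, h2⟩
    · rintro (h1 | ⟨h1, h2⟩)
      · exact ⟨h1.ge, (Fin.ext h1 : j = i) ▸ h⟩
      · exact ⟨by omega, h2⟩
  rw [countFrom, countFrom, this, Finset.card_insert_of_notMem (by simp)]
  simp

theorem countFrom_of_not_mem {q : Fin g → Prop} {i : Fin g} (h : ¬ q i) :
    countFrom q i = countFrom q (i + 1) := by
  classical
  have : (Finset.univ.filter fun j : Fin g => (i : ℕ) ≤ j ∧ q j)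
      = Finset.univ.filter fun j : Fin g => (i : ℕ) + 1 ≤ j ∧ q j := by
    ext j
    simp only [Finset.mem_filter, Finset.mem_univ, true_and]
    refine and_congr_left fun h2 => ⟨fun h1 => ?_, fun h1 => by omega⟩
    rcases h1.lt_or_eq with h3 | h3
    · exact h3
    · exact absurd ((Fin.ext h3 : i = j) ▸ h2) h
  rw [countFrom, countFrom, this]

theorem countFrom_nonneg (q : Fin g → Prop) (i : ℕ) : 0 ≤ countFrom q i := by simp [countFrom]

open Classical in
theorem countFrom_zero (q : Fin g → Prop) :
    countFrom q 0 = (Finset.univ.filter q).card := by simp [countFrom]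

theorem countFrom_add_not (q : Fin g → Prop) :
    ∀ i ≤ g, countFrom q i + countFrom (fun j => ¬ q j) i = g - i := by
  refine backward_induction ?_ fun i ih => ?_
  · simp [countFrom_genus]
  · push_cast at ih
    by_cases h : q i
    · rw [countFrom_of_mem h, countFrom_of_not_mem (q := fun j => ¬ q j) (by simpa using h)]
      omega
    · rw [countFrom_of_mem (q := fun j => ¬ q j) h, countFrom_of_not_mem h]
      omega

/-- The number of nonzero coordinates from the `i`-th on. -/
abbrev nz (x : ∀ i, Γ.Loop i) (i : ℕ) : ℤ := countFrom (fun j => x j ≠ 0) i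

theorem nz_of_eq {x : ∀ i, Γ.Loop i} {i : Fin g} (h : x i = 0) : nz x i = nz x (i + 1) :=
  countFrom_of_not_mem (by simpa using h)

theorem nz_of_ne {x : ∀ i, Γ.Loop i} {i : Fin g} (h : x i ≠ 0) : nz x i = nz x (i + 1) + 1 :=
  countFrom_of_mem (q := fun j => x j ≠ 0) h

theorem nz_nonneg (x : ∀ i, Γ.Loop i) (i : ℕ) : 0 ≤ nz x i := countFrom_nonneg _ _

theorem nz_genus (x : ∀ i, Γ.Loop i) : nz x g = 0 := countFrom_genus _

open Classical in
/-- The Abel-Jacobi image of a set of chips with at most one chip on each loop. -/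
theorem abel_sum_single (S : Finset (Fin g)) (y : ∀ i, Γ.Loop i) (i : Fin g) :
    Γ.abel i (∑ j ∈ S, Finsupp.single (Γ.loopPt j (y j)) 1)
      = (if i ∈ S then y i else 0) + Γ.mult i (countFrom (· ∈ S) (i + 1)) := by
  have hterm : ∀ j : Fin g, (if j ∈ S then Γ.aj i (Γ.loopPt j (y j)) else 0)
      = (if j = i then (if i ∈ S then y i else 0) else 0)
        + (if (i : ℕ) + 1 ≤ j ∧ j ∈ S then Γ.mult i 1 else 0) := by
    intro j
    rcases lt_trichotomy i j with h | rfl | h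
    · have : (i : ℕ) + 1 ≤ j := h
      simp [aj_loopPt_of_gt _ h, h.ne', this]
    · simp
    · have : ¬ (i : ℕ) + 1 ≤ j := by have : (j : ℕ) < i := h; omega
      simp only [aj_loopPt_of_lt _ h, h.ne, this]
      simp
  simp only [map_sum, abel_single, one_smul]
  rw [← Finset.sum_ite_mem_eq, Finset.sum_congr rfl fun j _ => hterm j,
    Finset.sum_add_distrib, Finset.sum_ite_eq',
    if_pos (Finset.mem_univ _), ← Finset.sum_filter, Finset.sum_const, countFrom,
    ← natCast_zsmul, smul_mult_one]
  congr!

theorem aj_v₁ (i : Fin g) : Γ.aj i Γ.v₁ = 0 := by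
  rw [v₁, v]
  rcases eq_or_ne (⟨0, Γ.genus_pos⟩ : Fin g) i with rfl | h
  · exact aj_loopPt_self _ _ _
  · refine aj_loopPt_of_lt _ (Fin.lt_def.2 (Nat.pos_of_ne_zero fun h' => h (Fin.ext h'.symm))) _

/-- The rightmost vertex. -/
def wLast (Γ : ChainOfLoops g) : Γ.Point :=
  Γ.loopPt ⟨g - 1, Nat.sub_lt Γ.genus_pos one_pos⟩ (Γ.mult _ 1)

theorem aj_wLast (j : Fin g) : Γ.aj j Γ.wLast = Γ.mult j 1 := by
  have : j ≤ ⟨g - 1, Nat.sub_lt Γ.genus_pos one_pos⟩ := Fin.le_def.2 (by simp only []; omega)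
  rcases this.lt_or_eq with h | rfl
  · exact aj_loopPt_of_gt _ h _
  · exact aj_loopPt_self _ _ _

theorem dataDivisor_eq (d₀ : ℕ) (x : ∀ i, Γ.Loop i) : ∃ S : Finset (Fin g),
    (∀ i, i ∈ S ↔ x i ≠ 0) ∧ Γ.dataDivisor d₀ x
      = Finsupp.single Γ.v₁ (d₀ : ℤ) + ∑ i ∈ S, Finsupp.single (Γ.loopPt i (x i)) 1 := by
  classical
  refine ⟨Finset.univ.filter fun i => x i ≠ 0, by simp, ?_⟩
  rw [dataDivisor, Finset.sum_filter]
  congr 1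
  refine Finset.sum_congr rfl fun i _ => ?_
  by_cases h : x i = 0 <;> simp [h]

theorem degHom_sum_single (S : Finset (Fin g)) (P : Fin g → Γ.Point) :
    Γ.degHom (∑ j ∈ S, Finsupp.single (P j) 1) = countFrom (· ∈ S) 0 := by
  classical
  simp [countFrom_zero]

theorem degHom_dataDivisor (d₀ : ℕ) (x : ∀ i, Γ.Loop i) :
    Γ.degHom (Γ.dataDivisor d₀ x) = d₀ + nz x 0 := by
  obtain ⟨S, hS, h⟩ := dataDivisor_eq d₀ x
  rw [h, map_add, degHom_sum_single, degHom_single]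
  simp only [hS]

/-- Besides the chip on loop `i` itself, each chip on a later loop retracts to `w i`, while the
chips further left retract to 0. -/
theorem abel_dataDivisor (d₀ : ℕ) (x : ∀ i, Γ.Loop i) (i : Fin g) :
    Γ.abel i (Γ.dataDivisor d₀ x) = x i + Γ.mult i (nz x (i + 1)) := by
  obtain ⟨S, hS, h⟩ := dataDivisor_eq d₀ x
  rw [h, map_add, abel_sum_single, abel_single, aj_v₁, smul_zero, zero_add]
  simp only [hS]
  congr 1
  by_cases h : x i = 0 <;> simp [h]

/-- For removing a chip that lies at or beyond the right end of the first `n` loops: the count and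
the value required for a lossless passage both drop by one, so hits and misses stay the same. -/
theorem leftWalk_shift {u u' : ∀ i, Γ.Loop i} {d : ℤ} (n : ℕ)
    (h : ∀ j : Fin g, (j : ℕ) < n → u' j = u j - Γ.mult j 1) :
    Γ.leftWalk u' (d - 1) n = Γ.leftWalk u d n - 1 := by
  induction n with
  | zero => rfl
  | succ n ih =>
    have ih := ih fun j hj => h j (by omega)
    rw [leftWalk, leftWalk, ih]
    have : (∃ hn : n < g, u' ⟨n, hn⟩ ≠ Γ.mult ⟨n, hn⟩ (Γ.leftWalk u d n - 1))
        ↔ ∃ hn : n < g, u ⟨n, hn⟩ ≠ Γ.mult ⟨n, hn⟩ (Γ.leftWalk u d n) := by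
      refine exists_congr fun hn => not_congr ?_
      rw [h ⟨n, hn⟩ (Nat.lt_succ_self n), mult_sub, sub_left_inj]
    simp only [this]
    split_ifs <;> rfl

/-- A walk below the one of the reduced divisor stays below it. -/
theorem leftWalk_lt {u x : ∀ i, Γ.Loop i} {d : ℤ} {n : ℕ} (hn : n ≤ g)
    (hu : ∀ j : Fin g, n ≤ j → u j = x j + Γ.mult j (nz x (j + 1)))
    (h : Γ.leftWalk u d n < nz x n) : Γ.leftWalk u d g < 0 := by
  have : ∀ k, n ≤ k → k ≤ g → Γ.leftWalk u d k < nz x k := by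
    intro k hk
    induction k, hk using Nat.le_induction with
    | base => exact fun _ => h
    | succ k hk ih =>
      intro hkg
      have ih := ih (by omega)
      have hle := leftWalk_le u d k
      by_cases hx : x ⟨k, hkg⟩ = 0
      · have := nz_of_eq hx
        simp only at this
        omega
      · have h1 := nz_of_ne hx
        simp only at h1
        by_contra hlt
        -- The walk could catch up only by passing this loop without loss, which would require the
        -- coordinate to be `nz x (k + 1)` times `m`, that is, `x k = 0`.
        have h2 : Γ.leftWalk u d k = nz x (k + 1) := by omega
        have h3 := leftWalk_miss (u := u) (d := d) (i := ⟨k, hkg⟩) (by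
          rw [hu ⟨k, hkg⟩ hk, h2]
          simpa using hx)
        simp only at h3
        omega
  simpa [nz_genus] using this g hn le_rfl

/-- A class of degree `g - 1` is effective only if it satisfies one of `g` conditions. -/
theorem leftWalk_neg {u : ∀ i, Γ.Loop i} (h : ∀ i, u i ≠ Γ.mult i ((g : ℤ) - 1 - i)) :
    Γ.leftWalk u ((g : ℤ) - 1) g < 0 := by
  have : ∀ k ≤ g, Γ.leftWalk u ((g : ℤ) - 1) k = (g : ℤ) - 1 - k := by
    intro k hk
    induction k with
    | zero => simp
    | succ k ih =>
      have ih := ih (by omega)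
      have := leftWalk_miss (u := u) (d := (g : ℤ) - 1) (i := ⟨k, hk⟩) (by
        simp only [ih]
        exact h ⟨k, hk⟩)
      simp only at this
      push_cast
      omega
  rw [this g le_rfl]
  omega

theorem sub_le_leftWalk (u : ∀ i, Γ.Loop i) (d : ℤ) (n : ℕ) : d - n ≤ Γ.leftWalk u d n := by
  induction n with
  | zero => simp
  | succ n ih =>
    have := sub_one_le_leftWalk u d n
    push_cast
    omega

theorem rankAtLeast_cls {r : ℕ} {D : Γ.Divisor} : Γ.RankAtLeast r (cls D) ↔
    ∀ E : Γ.Divisor, 0 ≤ E → Γ.degHom E = r →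
      0 ≤ Γ.leftWalk (fun i => Γ.abel i D - Γ.abel i E) (Γ.degHom D - r) g := by
  refine forall_congr' fun E => forall_congr' fun _ => forall_congr' fun hE => ?_
  rw [← cls_sub, exists_effective_iff]
  have hE : Γ.degHom E = r := hE
  simp only [map_sub, hE]

end ChainOfLoops

/-! ### Lattice paths of vertex avoiding classes. -/

namespace ChainOfLoops
variable {g : ℕ} {Γ : ChainOfLoops g} {r : ℕ}

/-- A lattice point with `r` coordinates, extended by zeros. -/
def extend (y : Fin r → ℤ) (s : ℕ) : ℤ := if h : s < r then y ⟨s, h⟩ else 0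

theorem extend_of_lt (y : Fin r → ℤ) {s : ℕ} (h : s < r) : extend y s = y ⟨s, h⟩ := dif_pos h

@[simp] theorem extend_fin (y : Fin r → ℤ) (j : Fin r) : extend y j = y j := dif_pos j.2

@[simp] theorem extend_self (y : Fin r → ℤ) : extend y r = 0 := dif_neg (lt_irrefl r)

theorem extend_add_le {y : Fin r → ℤ} (hy : y ∈ chamber r) {s t : ℕ} (hst : s ≤ t) (ht : t ≤ r) :
    extend y t + (t - s) ≤ extend y s := by
  induction t, hst using Nat.le_induction with
  | base => simp
  | succ t hst ih =>
    have ih := ih (by omega)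
    have : extend y (t + 1) < extend y t := by
      rw [extend_of_lt y (show t < r by omega)]
      by_cases h : t + 1 < r
      · rw [extend_of_lt y h]
        exact hy.1 (Fin.lt_def.2 (Nat.lt_succ_self t))
      · rw [show t + 1 = r by omega, extend_self]
        exact hy.2 _
    push_cast
    omega

/-- A step in a direction `j` is only blocked by the wall between `j` and `j - 1`. -/
theorem exists_wall {y : Fin r → ℤ} (hy : y ∈ chamber r) (j : Fin r)
    (h : y + Pi.single j 1 ∉ chamber r) : ∃ a, y a = y j + 1 := by
  by_contra! hne
  refine h ⟨fun a b hab => ?_, fun a => ?_⟩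
  · have hlt := hy.1 hab
    simp only [Pi.add_apply, Pi.single_apply]
    by_cases hb : b = j
    · subst hb
      have := hne a
      rw [if_pos rfl, if_neg hab.ne]
      omega
    · rw [if_neg hb]
      split_ifs <;> omega
  · have := hy.2 a
    simp only [Pi.add_apply, Pi.single_apply]
    split_ifs <;> omega

theorem step_up_unique {x : ∀ i, Γ.Loop i} {d₀ : ℕ} {p : Fin (g + 1) → Fin r → ℤ}
    (hp : Γ.IsLatticePath d₀ x p) {i : Fin g} (hx : x i ≠ 0) (j : Fin r) :
    p i.succ j = p i.castSucc j ∨ (Γ.CanStep x i (p i.castSucc) j ∧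
      p i.succ = p i.castSucc + Pi.single j 1) := by
  rcases hp.2 i with ⟨h, -⟩ | ⟨-, k, hk, h⟩ | ⟨-, -, h⟩
  · exact absurd h hx
  · by_cases hkj : j = k
    · subst hkj
      exact Or.inr ⟨hk, h⟩
    · left
      simp [h, hkj]
  · left
    rw [h]

/-- The coordinates stay in the range where genericity distinguishes the multiples of `m i`. -/
theorem path_le {x : ∀ i, Γ.Loop i} {d₀ : ℕ} {p : Fin (g + 1) → Fin r → ℤ}
    (hp : Γ.IsLatticePath d₀ x p) (i : Fin (g + 1)) (j : Fin r) :
    p i j + nz x i ≤ d₀ + nz x 0 := by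
  induction i using Fin.induction with
  | zero =>
    rw [hp.1 j]
    simp
  | succ i ih =>
    simp only [Fin.val_castSucc, Fin.val_succ] at ih ⊢
    by_cases hx : x i = 0
    · rw [nz_of_eq hx] at ih
      rcases hp.2 i with ⟨-, h⟩ | ⟨h, -⟩ | ⟨h, -⟩
      · rw [h]
        simp only [Pi.sub_apply, Pi.one_apply]
        omega
      · exact absurd hx h
      · exact absurd hx h
    · rw [nz_of_ne hx] at ih
      rcases step_up_unique hp hx j with h | ⟨-, h⟩
      · rw [h]
        omega
      · rw [h]
        simp only [Pi.add_apply, Pi.single_eq_same]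
        omega

/-- If direction `j` were called for and allowed, the path would take it, since by genericity no
other direction is called for at the same point. If a wall blocks it, some coordinate equals `p j +
1`, and then vertex avoidance excludes this position of the chip. -/
theorem ne_mult_of_linger (hΓ : Γ.IsGeneric) {x : ∀ i, Γ.Loop i} {d₀ : ℕ}
    {p : Fin (g + 1) → Fin r → ℤ} (hp : Γ.IsLatticePath d₀ x p)
    (hd : (d₀ : ℤ) + nz x 0 ≤ 2 * g - 2) (hv : ∀ i j, x i ≠ Γ.mult i (p i.castSucc j))
    {i : Fin g} (hx : x i ≠ 0) (hch : p i.castSucc ∈ chamber r) (j : Fin r)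
    (h : p i.succ j = p i.castSucc j) : x i ≠ Γ.mult i (p i.castSucc j + 1) := by
  intro hxj
  by_cases hcan : p i.castSucc + Pi.single j 1 ∈ chamber r
  · rcases hp.2 i with ⟨h0, -⟩ | ⟨-, k, hk, h1⟩ | ⟨-, h1, -⟩
    · exact hx h0
    · have h2 := hk.1
      rw [hxj] at h2
      have b1 := path_le hp i.castSucc j
      have b2 := path_le hp i.castSucc k
      have c1 := hch.2 j
      have c2 := hch.2 k
      have c3 := nz_nonneg x i.castSucc
      have := hΓ.mult_injective i (by omega) (by omega) h2
      have : j = k := hch.1.injective (by omega)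
      subst this
      rw [h1] at h
      simp at h
    · exact h1 j ⟨hxj, hch, hcan⟩
  · obtain ⟨a, ha⟩ := exists_wall hch j hcan
    exact hv i a (by rw [ha, hxj])

/-- If the rank is at least `r`, then the lattice path does not leave the chamber. -/
theorem path_mem_chamber (hΓ : Γ.IsGeneric) {x : ∀ i, Γ.Loop i} {d₀ : ℕ}
    {p : Fin (g + 1) → Fin r → ℤ} (hp : Γ.IsLatticePath d₀ x p)
    (hd : (d₀ : ℤ) + nz x 0 ≤ 2 * g - 2) (hv : ∀ i j, x i ≠ Γ.mult i (p i.castSucc j))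
    (hrank : Γ.RankAtLeast r (cls (Γ.dataDivisor d₀ x))) (i : Fin (g + 1)) :
    p i ∈ chamber r := by
  rw [rankAtLeast_cls] at hrank
  simp only [abel_dataDivisor, degHom_dataDivisor] at hrank
  set u : ∀ i, Γ.Loop i := fun i => x i + Γ.mult i (nz x (i + 1)) with hu
  -- Otherwise removing `r` chips at `v₁` starts the walk below `nz x 0`, and it never recovers.
  have hd₀ : r ≤ d₀ := by
    by_contra hlt
    have h1 := hrank (Finsupp.single Γ.v₁ (r : ℤ)) (Finsupp.single_nonneg.2 (by simp)) (by simp)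
    simp only [abel_single, aj_v₁, smul_zero, sub_zero] at h1
    have h2 := leftWalk_lt (u := u) (x := x) (d := d₀ + nz x 0 - r) (n := 0) (by omega)
      (fun j _ => rfl) (by rw [leftWalk_zero]; omega)
    exact absurd h2 (not_lt.2 h1)
  -- After subtracting `j` chips at `v₁`, at most `p i j` chips can be brought to loop `i` in excess
  -- of one for each nonzero `x` from there on.
  have key : p i ∈ chamber r ∧
      ∀ j : Fin r, Γ.leftWalk u (d₀ + nz x 0 - (j : ℕ)) i ≤ p i j + nz x i := by
    induction i using Fin.induction with
    | zero =>
      refine ⟨⟨fun a b hab => ?_, fun j => ?_⟩, fun j => ?_⟩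
      · have : (a : ℕ) < b := hab
        rw [hp.1, hp.1]
        omega
      · rw [hp.1]
        omega
      · rw [hp.1]
        simp only [Fin.val_zero, leftWalk_zero]
        omega
    | succ i ih =>
      obtain ⟨hch, hadv⟩ := ih
      simp only [Fin.val_castSucc, Fin.val_succ] at hadv ⊢
      by_cases hx : x i = 0
      · have hstep : p i.succ = p i.castSucc - 1 := by
          rcases hp.2 i with ⟨-, h⟩ | ⟨h, -⟩ | ⟨h, -⟩
          · exact h
          · exact absurd hx h
          · exact absurd hx h
        have hadv' : ∀ j : Fin r, Γ.leftWalk u (d₀ + nz x 0 - (j : ℕ)) (i + 1)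
            ≤ p i.succ j + nz x (i + 1) := by
          intro j
          have h1 := hadv j
          have h2 := leftWalk_le u (d₀ + nz x 0 - (j : ℕ)) i
          rw [nz_of_eq hx] at h1
          rw [hstep, Pi.sub_apply, Pi.one_apply]
          by_contra hlt
          have h3 : Γ.leftWalk u (d₀ + nz x 0 - (j : ℕ)) i = p i.castSucc j + nz x (i + 1) := by
            omega
          have h4 := leftWalk_miss (u := u) (d := d₀ + nz x 0 - (j : ℕ)) (i := i) (by
            rw [h3, mult_add]
            simpa [hu] using hv i j)
          omega
        have hanti : StrictAnti (p i.succ) := by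
          intro a b hab
          have := hch.1 hab
          rw [hstep]
          simp only [Pi.sub_apply, Pi.one_apply]
          omega
        refine ⟨⟨hanti, fun j => ?_⟩, hadv'⟩
        have hr : r - 1 < r := by have := j.2; omega
        let l : Fin r := ⟨r - 1, hr⟩
        refine lt_of_lt_of_le ?_ (hanti.antitone (show j ≤ l from Fin.le_def.2 (by
          simp only [l]; have := j.2; omega)))
        -- If the last coordinate became nonpositive, then after removing `r - 1` chips at `v₁`
        -- there would be no excess beyond loop `i`. Removing one more chip at `w i` would push the
        -- walk below `nz x`, contradicting the rank.
        by_contra hneg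
        let E : Γ.Divisor := Finsupp.single Γ.v₁ ((r : ℤ) - 1)
          + Finsupp.single (Γ.loopPt i (Γ.mult i 1)) 1
        have hE : ∀ k, Γ.abel k E = Γ.aj k (Γ.loopPt i (Γ.mult i 1)) := by
          intro k
          simp [E, aj_v₁]
        have h1 := hrank E (add_nonneg (Finsupp.single_nonneg.2 (by omega))
          (Finsupp.single_nonneg.2 (by simp))) (by simp [E])
        simp only [hE] at h1
        have h2 := leftWalk_shift (u := u)
          (u' := fun k => u k - Γ.aj k (Γ.loopPt i (Γ.mult i 1))) (d := d₀ + nz x 0 - (l : ℕ)) (i + 1)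
          (fun k hk => by
            rcases (show k ≤ i from Fin.le_def.2 (by omega)).lt_or_eq with h | rfl
            · simp only [aj_loopPt_of_gt _ h]
            · simp only [aj_loopPt_self])
        have hl : (d₀ : ℤ) + nz x 0 - (l : ℕ) - 1 = d₀ + nz x 0 - r := by
          simp only [l]; omega
        rw [hl] at h2
        have h3 := hadv' l
        have h4 := leftWalk_lt (u := fun k => u k - Γ.aj k (Γ.loopPt i (Γ.mult i 1))) (x := x)
          (d := d₀ + nz x 0 - r) (n := i + 1) i.2
          (fun k hk => by
            simp only [aj_loopPt_of_lt _ (show i < k from hk), sub_zero]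
            rfl)
          (by omega)
        exact absurd h4 (not_lt.2 h1)
      · refine ⟨?_, fun j => ?_⟩
        · rcases hp.2 i with ⟨h, -⟩ | ⟨-, j, h1, h2⟩ | ⟨-, -, h2⟩
          · exact absurd h hx
          · rw [h2]; exact h1.2.2
          · rw [h2]; exact hch
        · have h1 := hadv j
          have h2 := leftWalk_le u (d₀ + nz x 0 - (j : ℕ)) i
          rw [nz_of_ne hx] at h1
          rcases step_up_unique hp hx j with h | ⟨-, h⟩
          · by_contra hlt
            have h3 : Γ.leftWalk u (d₀ + nz x 0 - (j : ℕ)) i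
                = p i.castSucc j + 1 + nz x (i + 1) := by omega
            have h4 := leftWalk_miss (u := u) (d := d₀ + nz x 0 - (j : ℕ)) (i := i) (by
              rw [h3, mult_add]
              simpa [hu] using ne_mult_of_linger hΓ hp hd hv hx hch j h)
            omega
          · rw [h]
            simp only [Pi.add_apply, Pi.single_eq_same]
            omega
  exact key.1

/-- The properties of the lattice paths of vertex avoiding classes, with a zero coordinate added
to the lattice points. -/
structure IsTightPath (Γ : ChainOfLoops g) (r : ℕ) (x : ∀ i, Γ.Loop i)
    (p : Fin (g + 1) → Fin r → ℤ) : Prop where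
  start : ∀ s ≤ r, extend (p 0) s = (r : ℤ) - s
  finish : ∀ s ≤ r, extend (p (Fin.last g)) s = (r : ℤ) - s
  mem_chamber : ∀ i, p i ∈ chamber r
  le : ∀ i j, p i j ≤ 2 * (g : ℤ) - 2
  down : ∀ i, x i = 0 → p i.succ = p i.castSucc - 1
  up : ∀ i, x i ≠ 0 → ∀ j, p i.succ j = p i.castSucc j ∨
    (x i = Γ.mult i (p i.castSucc j + 1) ∧ p i.succ = p i.castSucc + Pi.single j 1)
  linger : ∀ i, x i ≠ 0 → ∀ s ≤ r, extend (p i.succ) s = extend (p i.castSucc) s →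
    x i ≠ Γ.mult i (extend (p i.castSucc) s + 1)
  avoid : ∀ i j, x i ≠ Γ.mult i (p i.castSucc j)

/-- Each unit step raises the coordinate sum by 1, and each step (-1, ..., -1) lowers it by r. -/
theorem sum_path {x : ∀ i, Γ.Loop i} {d₀ : ℕ} {p : Fin (g + 1) → Fin r → ℤ}
    (hp : Γ.IsLatticePath d₀ x p) (i : Fin (g + 1)) :
    ∑ j, p (Fin.last g) j = ∑ j, p i j + countFrom (fun i => x i ≠ 0 ∧ p i.succ ≠ p i.castSucc) i
      - r * countFrom (fun i => ¬ x i ≠ 0) i := by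
  induction i using Fin.reverseInduction with
  | last => simp [countFrom_genus]
  | cast i ih =>
    rw [ih]
    simp only [Fin.val_castSucc, Fin.val_succ]
    rcases hp.2 i with ⟨hx, h⟩ | ⟨hx, j, -, h⟩ | ⟨hx, -, h⟩
    · rw [countFrom_of_not_mem (i := i) (q := fun i => x i ≠ 0 ∧ p i.succ ≠ p i.castSucc)
        (by simp [hx]), countFrom_of_mem (i := i) (q := fun i => ¬ x i ≠ 0) (by simpa using hx), h]
      simp only [Pi.sub_apply, Pi.one_apply, Finset.sum_sub_distrib, Finset.sum_const,
        Finset.card_univ, Fintype.card_fin, nsmul_eq_mul]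
      ring
    · rw [countFrom_of_mem (i := i) (q := fun i => x i ≠ 0 ∧ p i.succ ≠ p i.castSucc)
        ⟨hx, by rw [h]; simp⟩,
        countFrom_of_not_mem (i := i) (q := fun i => ¬ x i ≠ 0) (by simpa using hx), h]
      simp only [Pi.add_apply, Finset.sum_add_distrib, Finset.sum_pi_single', Finset.mem_univ, if_true]
      ring
    · rw [countFrom_of_not_mem (i := i) (q := fun i => x i ≠ 0 ∧ p i.succ ≠ p i.castSucc)
        (by simp [h]),
        countFrom_of_not_mem (i := i) (q := fun i => ¬ x i ≠ 0) (by simpa using hx), h]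

theorem ncard_eq_countFrom (q : Fin g → Prop) : (Set.ncard {i | q i} : ℤ) = countFrom q 0 := by
  classical
  rw [countFrom_zero, ← Set.ncard_coe_finset]
  simp

theorem count_steps {x : ∀ i, Γ.Loop i} {p : Fin (g + 1) → Fin r → ℤ} :
    (Set.ncard {i : Fin g | x i ≠ 0 ∧ p i.succ = p i.castSucc} : ℤ)
      + countFrom (fun i => x i ≠ 0 ∧ p i.succ ≠ p i.castSucc) 0
      + countFrom (fun i => ¬ x i ≠ 0) 0 = g := by
  have h2 : ∀ i ≤ g, countFrom (fun i => x i ≠ 0 ∧ p i.succ = p i.castSucc) i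
      + countFrom (fun i => x i ≠ 0 ∧ p i.succ ≠ p i.castSucc) i
      + countFrom (fun i => ¬ x i ≠ 0) i = g - i := by
    refine backward_induction ?_ fun i ih => ?_
    · simp [countFrom_genus]
    · push_cast at ih
      by_cases hx : x i = 0
      · rw [countFrom_of_not_mem (q := fun i => x i ≠ 0 ∧ p i.succ = p i.castSucc) (by simp [hx]),
          countFrom_of_not_mem (q := fun i => x i ≠ 0 ∧ p i.succ ≠ p i.castSucc) (by simp [hx]),
          countFrom_of_mem (q := fun i => ¬ x i ≠ 0) (by simpa using hx)]
        omega
      · rw [countFrom_of_not_mem (q := fun i => ¬ x i ≠ 0) (by simpa using hx)]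
        by_cases h : p i.succ = p i.castSucc
        · rw [countFrom_of_mem (q := fun i => x i ≠ 0 ∧ p i.succ = p i.castSucc) ⟨hx, h⟩,
            countFrom_of_not_mem (q := fun i => x i ≠ 0 ∧ p i.succ ≠ p i.castSucc) (by simp [h])]
          omega
        · rw [countFrom_of_not_mem (q := fun i => x i ≠ 0 ∧ p i.succ = p i.castSucc) (by simp [h]),
            countFrom_of_mem (q := fun i => x i ≠ 0 ∧ p i.succ ≠ p i.castSucc) ⟨hx, h⟩]
          omega
  rw [ncard_eq_countFrom, h2 0 (by omega)]
  simp

/-- With ρ lingering steps, the coordinates of the end point exceed those of (r, ..., 1) by r - d₀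
in total. The chamber makes each excess nonnegative, and at the start it gives d₀ ≥ r. So everything
is an equality. -/
theorem isTightPath (hΓ : Γ.IsGeneric) {x : ∀ i, Γ.Loop i} {d₀ : ℕ} {d : ℤ}
    {p : Fin (g + 1) → Fin r → ℤ} (hp : Γ.IsLatticePath d₀ x p)
    (hd : (d₀ : ℤ) + nz x 0 = d) (hpos : 0 < (g : ℤ) - d + r)
    (hcount : (Set.ncard {i : Fin g | x i ≠ 0 ∧ p i.succ = p i.castSucc} : ℤ) = rho g r d)
    (hw : ∀ i, x i ≠ Γ.mult i 1) (hv : ∀ i j, x i ≠ Γ.mult i (p i.castSucc j))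
    (hrank : Γ.RankAtLeast r (cls (Γ.dataDivisor d₀ x))) :
    Γ.IsTightPath r x p ∧ d₀ = r := by
  have hcs := count_steps (x := x) (p := p)
  have hnz := countFrom_add_not (fun i => x i ≠ 0) 0 (by omega)
  rw [hcount, rho] at hcs
  have hU := countFrom_nonneg (fun i => x i ≠ 0 ∧ p i.succ ≠ p i.castSucc) 0
  have hZ := countFrom_nonneg (fun i => ¬ x i ≠ 0) 0
  have hL : 0 ≤ rho g r d := by rw [← hcount]; positivity
  rw [rho] at hL
  -- From ρ ≥ 0 and g - d + r ≥ 1; this degree bound is what makes the range of the genericity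
  -- assumption sufficient.
  have hd2 : d ≤ 2 * g - 2 := by nlinarith
  have hd2' : (d₀ : ℤ) + nz x 0 ≤ 2 * g - 2 := hd ▸ hd2
  have hch := path_mem_chamber hΓ hp hd2' hv hrank
  have hsum := sum_path hp 0
  have hge : ∀ j : Fin r, 0 ≤ p (Fin.last g) j - ((r : ℤ) - (j : ℕ)) := by
    intro j
    have := extend_add_le (hch (Fin.last g)) (s := j) (t := r) j.2.le le_rfl
    rw [extend_fin, extend_self] at this
    omega
  have hsum' : ∑ j : Fin r, (p (Fin.last g) j - ((r : ℤ) - (j : ℕ))) = r - d₀ := by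
    have h0 : ∑ j, p 0 j = ∑ j : Fin r, ((r : ℤ) - (j : ℕ)) + r * (d₀ - r) := by
      have : ∀ j : Fin r, p 0 j = ((r : ℤ) - (j : ℕ)) + ((d₀ : ℤ) - r) := by
        intro j; rw [hp.1]; ring
      rw [Finset.sum_congr rfl fun j _ => this j, Finset.sum_add_distrib]
      simp
      ring
    rw [Finset.sum_sub_distrib, hsum, h0]
    simp only [Fin.val_zero]
    push_cast at hnz
    rw [nz] at hd
    linear_combination hcs + (r + 1) * (hd - hnz)
  have hr : (d₀ : ℤ) = r := by
    refine le_antisymm ?_ ?_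
    · have := Finset.sum_nonneg fun (j : Fin r) (_ : j ∈ Finset.univ) => hge j
      omega
    · rcases Nat.eq_zero_or_pos r with h | h
      · omega
      · have h1 := extend_add_le (hch 0) (s := 0) (t := r) (by omega) le_rfl
        rw [extend_self, extend_of_lt _ h, hp.1] at h1
        simp only [] at h1
        push_cast at h1
        omega
  rw [hr, sub_self, Finset.sum_eq_zero_iff_of_nonneg fun j _ => hge j] at hsum'
  refine ⟨⟨fun s hs => ?_, fun s hs => ?_, hch, fun i j => ?_, fun i hx => ?_, fun i hx j => ?_,
    fun i hx s hs h => ?_, hv⟩, by exact_mod_cast hr⟩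
  · rcases hs.lt_or_eq with h | rfl
    · rw [extend_of_lt _ h, hp.1, hr]
    · simp
  · rcases hs.lt_or_eq with h | rfl
    · rw [extend_of_lt _ h]
      have := hsum' ⟨s, h⟩ (Finset.mem_univ _)
      simp only at this
      omega
    · simp
  · have := path_le hp i j
    have := nz_nonneg x i
    omega
  · rcases hp.2 i with ⟨-, h⟩ | ⟨h, -⟩ | ⟨h, -⟩
    · exact h
    · exact absurd hx h
    · exact absurd hx h
  · exact (step_up_unique hp hx j).imp_right fun h => ⟨h.1.1, h.2⟩
  · rcases hs.lt_or_eq with hs | rfl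
    · rw [extend_of_lt _ hs, extend_of_lt _ hs] at h
      rw [extend_of_lt _ hs]
      exact ne_mult_of_linger hΓ hp hd2' hv hx (hch _) _ h
    · rw [extend_self, zero_add]
      exact hw i

end ChainOfLoops

/-! ### Local sufficiency of the equations, and the translates of the theta divisor. -/

namespace ChainOfLoops
variable {g : ℕ} {Γ : ChainOfLoops g} {r : ℕ}

/-- The chips on the lingering loops can be moved without decreasing the rank below `r`. -/
theorem IsTightPath.rankAtLeast {x : ∀ i, Γ.Loop i} {p : Fin (g + 1) → Fin r → ℤ}
    (hT : Γ.IsTightPath r x p) {D : Γ.Divisor} {x' : ∀ i, Γ.Loop i}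
    (hdeg : Γ.degHom D = r + nz x 0) (habel : ∀ i, Γ.abel i D = x' i + Γ.mult i (nz x (i + 1)))
    (h0 : ∀ i, x i = 0 → x' i = 0)
    (h1 : ∀ i, x i ≠ 0 → ∀ j, p i.succ j = p i.castSucc j ∨
      (x' i = Γ.mult i (p i.castSucc j + 1) ∧ p i.succ = p i.castSucc + Pi.single j 1)) :
    Γ.RankAtLeast r (cls D) := by
  rw [rankAtLeast_cls]
  intro E hE hEr
  simp only [habel, hdeg]
  set u : ∀ i, Γ.Loop i := fun i => x' i + Γ.mult i (nz x (i + 1)) - Γ.abel i E with hu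
  rw [add_sub_cancel_left]
  have hν : ∀ i : Fin (g + 1), 0 ≤ Γ.chipsFrom i E := fun i =>
    backward_induction (q := fun i => 0 ≤ Γ.chipsFrom i E) (chipsFrom_genus _ _).ge
      (fun i ih => ih.trans (chipsFrom_succ_le hE i)) i (Nat.lt_succ_iff.1 i.2)
  -- Here `s` is the number of chips of `E` left of loop `i`, which selects the coordinate of the
  -- path bounding the walk of `D - E`. At the end `s = r`, and the added zero coordinate gives the
  -- nonnegativity wanted.
  have key : ∀ i : Fin (g + 1), ∃ s : ℕ, s ≤ r ∧ (s : ℤ) = r - Γ.chipsFrom i E ∧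
      extend (p i) s + nz x i ≤ Γ.leftWalk u (nz x 0) i + Γ.chipsFrom i E := by
    intro i
    induction i using Fin.induction with
    | zero =>
      refine ⟨0, by omega, ?_, ?_⟩
      · simp only [Fin.val_zero, chipsFrom_zero, hEr]; simp
      · rw [hT.start 0 (by omega)]
        simp only [Fin.val_zero, chipsFrom_zero, hEr, leftWalk_zero]
        simp [add_comm]
    | succ i ih =>
      obtain ⟨s, hs, hsν, hle⟩ := ih
      simp only [Fin.val_castSucc, Fin.val_succ] at hsν hle ⊢
      have hν' := hν i.succ
      simp only [Fin.val_succ] at hν'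
      have hmono := chipsFrom_succ_le hE i
      obtain ⟨a, ha⟩ := Int.eq_ofNat_of_zero_le (sub_nonneg.2 hmono)
      have hstep := sub_one_le_leftWalk u (nz x 0) i
      refine ⟨s + a, by omega, by push_cast; omega, ?_⟩
      -- Here `a` is the number of chips of `E` on loop `i`. If there are none, a possible loss of
      -- the walk is paid for by a drop of the coordinate or of `nz`; in the remaining cases (a step
      -- in direction `s`, or `x i = 0` with `s = r`) tightness of the bound forces a hit (`hmiss`).
      rcases Nat.eq_zero_or_pos a with rfl | hapos
      · have hab := abel_of_chipsFrom_eq hE i (by omega)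
        rw [add_zero]
        by_contra hlt
        have hmiss : Γ.leftWalk u (nz x 0) i + Γ.chipsFrom (i + 1) E
            = extend (p i.castSucc) s + nz x i → u i = Γ.mult i (Γ.leftWalk u (nz x 0) i) → False := by
          intro h2 h3
          have h4 := leftWalk_hit h3
          rw [h4] at hlt
          by_cases hx : x i = 0
          · rw [← nz_of_eq hx] at hlt
            have : extend (p i.succ) s ≤ extend (p i.castSucc) s := by
              rcases hs.lt_or_eq with h | rfl
              · rw [extend_of_lt _ h, extend_of_lt _ h, hT.down i hx]
                simp
              · simp
            omega
          · rw [nz_of_ne hx] at h2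
            have : extend (p i.succ) s ≤ extend (p i.castSucc) s + 1 := by
              rcases hs.lt_or_eq with h | rfl
              · rw [extend_of_lt _ h, extend_of_lt _ h]
                rcases h1 i hx ⟨s, h⟩ with h' | ⟨-, h'⟩
                · omega
                · rw [h']; simp
              · simp
            omega
        by_cases hx : x i = 0
        · have hn := nz_of_eq hx
          rcases hs.lt_or_eq with h | rfl
          · have : extend (p i.succ) s = extend (p i.castSucc) s - 1 := by
              rw [extend_of_lt _ h, extend_of_lt _ h, hT.down i hx]
              simp
            omega
          · rw [extend_self] at hlt hle hmiss
            have h2 : Γ.leftWalk u (nz x 0) i = nz x i - Γ.chipsFrom (i + 1) E := by omega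
            refine hmiss (by omega) ?_
            rw [h2, hu]
            simp only [h0 i hx, hab, zero_add]
            rw [mult_sub, hn]
        · have hn := nz_of_ne hx
          rcases hs.lt_or_eq with h | rfl
          · rcases h1 i hx ⟨s, h⟩ with h' | ⟨h', h''⟩
            · rw [extend_of_lt _ h] at hlt hle
              omega
            · have h3 : extend (p i.succ) s = extend (p i.castSucc) s + 1 := by
                rw [extend_of_lt _ h, extend_of_lt _ h, h'']
                simp
              have h2 : Γ.leftWalk u (nz x 0) i
                  = extend (p i.castSucc) s + 1 + nz x (i + 1) - Γ.chipsFrom (i + 1) E := by omega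
              refine hmiss (by omega) ?_
              rw [h2, hu]
              simp only [h', hab, extend_of_lt _ h]
              rw [mult_sub, mult_add _ _ _ (nz x (i + 1))]
          · rw [extend_self] at hlt hle
            omega
      -- Advancing from coordinate `s` to `s + a` lowers the bound by at least `a`, which
      -- compensates for the chips of `E` on this loop. The further loss of at most one chip is
      -- covered by the drop of the coordinate or of `nz`.
      · have hsr : s < r := by omega
        have hch := hT.mem_chamber i.succ
        have hanti' := extend_add_le hch (s := s) (t := s + a) (by omega) (by omega)
        have hanti := extend_add_le (hT.mem_chamber i.castSucc) (s := s) (t := s + a) (by omega)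
          (by omega)
        push_cast at hanti hanti'
        by_cases hx : x i = 0
        · have hn := nz_of_eq hx
          have : extend (p i.succ) s = extend (p i.castSucc) s - 1 := by
            rw [extend_of_lt _ hsr, extend_of_lt _ hsr, hT.down i hx]
            simp
          omega
        · have hn := nz_of_ne hx
          rcases h1 i hx ⟨s, hsr⟩ with h' | ⟨-, h'⟩
          · have : extend (p i.succ) s = extend (p i.castSucc) s := by
              rw [extend_of_lt _ hsr, extend_of_lt _ hsr, h']
            omega
          · have : extend (p i.succ) (s + a) = extend (p i.castSucc) (s + a) := by
              by_cases h : s + a < r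
              · have hne : (⟨s + a, h⟩ : Fin r) ≠ ⟨s, hsr⟩ := by
                  rw [Ne, Fin.mk.injEq]
                  omega
                rw [extend_of_lt _ h, extend_of_lt _ h, h']
                simp [hne]
              · rw [show s + a = r by omega, extend_self, extend_self]
            omega
  obtain ⟨s, hs, hsν, hle⟩ := key (Fin.last g)
  simp only [Fin.val_last, chipsFrom_genus, nz_genus] at hsν hle
  have : s = r := by omega
  rw [this, extend_self] at hle
  omega

/-- The loop `i` contributes a step in the direction `s`, where `s = r` for the steps
`(-1, …, -1)`. -/
def IsStep (x : ∀ i, Γ.Loop i) (p : Fin (g + 1) → Fin r → ℤ) (s : ℕ) (i : Fin g) : Prop :=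
  (s < r ∧ extend (p i.succ) s = extend (p i.castSucc) s + 1) ∨ (s = r ∧ x i = 0)

/-- The remaining steps must bring coordinate `s` back to r - s. At the start this says that every
direction occurs as often as (-1, ..., -1). -/
theorem IsTightPath.count_isStep {x : ∀ i, Γ.Loop i} {p : Fin (g + 1) → Fin r → ℤ}
    (hT : Γ.IsTightPath r x p) {s : ℕ} (hs : s ≤ r) (i : Fin (g + 1)) :
    countFrom (fun i => ¬ x i ≠ 0) i - countFrom (IsStep x p s) i
      = extend (p i) s - ((r : ℤ) - s) := by
  induction i using Fin.reverseInduction with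
  | last => simp [countFrom_genus, hT.finish s hs]
  | cast i ih =>
    simp only [Fin.val_castSucc, Fin.val_succ] at ih ⊢
    by_cases hx : x i = 0
    · rw [countFrom_of_mem (i := i) (q := fun i => ¬ x i ≠ 0) (by simpa using hx)]
      rcases hs.lt_or_eq with h | rfl
      · have : extend (p i.succ) s = extend (p i.castSucc) s - 1 := by
          rw [extend_of_lt _ h, extend_of_lt _ h, hT.down i hx]
          simp
        rw [countFrom_of_not_mem (i := i) (q := IsStep x p s)]
        · omega
        · rintro (⟨-, h'⟩ | ⟨h', -⟩) <;> omega
      · rw [countFrom_of_mem (i := i) (q := IsStep x p s) (Or.inr ⟨rfl, hx⟩)]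
        rw [extend_self] at ih ⊢
        omega
    · rw [countFrom_of_not_mem (i := i) (q := fun i => ¬ x i ≠ 0) (by simpa using hx)]
      by_cases hstep : IsStep x p s i
      · rw [countFrom_of_mem (i := i) (q := IsStep x p s) hstep]
        rcases hstep with ⟨-, h⟩ | ⟨-, h⟩
        · omega
        · exact absurd h hx
      · rw [countFrom_of_not_mem (i := i) (q := IsStep x p s) hstep]
        have : extend (p i.succ) s = extend (p i.castSucc) s := by
          rcases hs.lt_or_eq with h | rfl
          · rcases hT.up i hx ⟨s, h⟩ with h' | ⟨-, h'⟩
            · rw [extend_of_lt _ h, extend_of_lt _ h, h']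
            · refine absurd (Or.inl ⟨h, ?_⟩) hstep
              rw [extend_of_lt _ h, extend_of_lt _ h, h']
              simp
          · simp
        omega

theorem exists_isStep {x : ∀ i, Γ.Loop i} {p : Fin (g + 1) → Fin r → ℤ}
    (hT : Γ.IsTightPath r x p) {i : Fin g} (h : ¬ (x i ≠ 0 ∧ p i.succ = p i.castSucc)) :
    ∃ s ≤ r, IsStep x p s i := by
  by_cases hx : x i = 0
  · exact ⟨r, le_rfl, Or.inr ⟨rfl, hx⟩⟩
  · by_contra! hne
    refine h ⟨hx, funext fun j => ?_⟩
    rcases hT.up i hx j with h' | ⟨-, h'⟩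
    · exact h'
    · refine absurd (Or.inl ⟨j.2, ?_⟩) (hne j j.2.le)
      rw [extend_fin, extend_fin, h']
      simp

/-- For each loop that does not linger, there is a translate of the theta divisor which,
close to the given class, is cut out by fixing the chip on this loop. -/
theorem IsTightPath.exists_translate (hΓ : Γ.IsGeneric) {x : ∀ i, Γ.Loop i}
    {p : Fin (g + 1) → Fin r → ℤ} (hT : Γ.IsTightPath r x p) {s : ℕ} (hs : s ≤ r) {k : Fin g}
    (hk : IsStep x p s k) : ∃ E F : Γ.Divisor, 0 ≤ E ∧ Γ.degHom E = r ∧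
      0 ≤ F ∧ Γ.degHom F = g - nz x 0 - 1 ∧
      ∀ i, x i + Γ.mult i (nz x (i + 1)) - Γ.abel i E + Γ.abel i F
        = Γ.mult i ((g : ℤ) - 1 - i) ↔ i = k := by
  classical
  let S : Finset (Fin g) := Finset.univ.filter fun i => IsStep x p s i ∧ i ≠ k
  have hS : ∀ i, i ∈ S ↔ IsStep x p s i ∧ i ≠ k := by simp [S]
  have hcount : ∀ i ≤ g, countFrom (IsStep x p s) i
      = countFrom (· ∈ S) i + if i ≤ k then 1 else 0 := by
    refine backward_induction ?_ fun i ih => ?_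
    · rw [countFrom_genus, countFrom_genus, if_neg (by have := k.2; omega), add_zero]
    · by_cases hik : i = k
      · subst hik
        rw [countFrom_of_mem hk, countFrom_of_not_mem (q := (· ∈ S)) (by simp [hS]), ih,
          if_neg (by omega), if_pos le_rfl, add_zero]
      · have hik' : (i : ℕ) ≠ k := fun h => hik (Fin.ext h)
        have hle : (i : ℕ) + 1 ≤ k ↔ (i : ℕ) ≤ k := by omega
        simp only [hle] at ih
        by_cases h : IsStep x p s i
        · rw [countFrom_of_mem h, countFrom_of_mem (q := (· ∈ S)) ((hS i).2 ⟨h, hik⟩), ih]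
          omega
        · rw [countFrom_of_not_mem h, countFrom_of_not_mem (q := (· ∈ S)) fun h' => h ((hS i).1 h').1,
            ih]
  -- This is the position that a chip of the second divisor would need on loop `i` for the i-th
  -- condition to hold (`hcond`), with 0 standing for no chip. Having two points to choose from, `y
  -- i` avoids it.
  let t : ∀ i, Γ.Loop i := fun i => Γ.mult i (extend (p i.succ) s + if i < k then 1 else 0) - x i
  let y : ∀ i, Γ.Loop i := fun i => if t i = 0 then Γ.mult i 1 else 0
  have hy : ∀ i, y i ≠ t i := by
    intro i h
    by_cases ht : t i = 0
    · simp only [y, if_pos ht] at h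
      exact Γ.mult_one_ne_zero i (h.trans ht)
    · simp only [y, if_neg ht] at h
      exact ht h.symm
  -- Chips at the two ends of the graph select coordinate `s` of the path; the second divisor has
  -- one chip on each other loop stepping in direction `s`.
  refine ⟨Finsupp.single Γ.v₁ (s : ℤ) + Finsupp.single Γ.wLast ((r : ℤ) - s),
    ∑ j ∈ S, Finsupp.single (Γ.loopPt j (y j)) 1,
    add_nonneg (Finsupp.single_nonneg.2 (by omega)) (Finsupp.single_nonneg.2 (by omega)), by simp,
    Finset.sum_nonneg fun j _ => Finsupp.single_nonneg.2 zero_le_one, ?_, fun i => ?_⟩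
  · rw [degHom_sum_single]
    have h1 := hcount 0 (by omega)
    have h2 := hT.count_isStep hs 0
    have h3 := countFrom_add_not (fun i => x i ≠ 0) 0 (by omega)
    rw [hT.start s hs] at h2
    simp only [Fin.val_zero, Nat.zero_le, if_true] at h1 h2
    push_cast at h3
    rw [nz]
    omega
  · have hcond : x i + Γ.mult i (nz x (i + 1))
        - Γ.abel i (Finsupp.single Γ.v₁ (s : ℤ) + Finsupp.single Γ.wLast ((r : ℤ) - s))
        + Γ.abel i (∑ j ∈ S, Finsupp.single (Γ.loopPt j (y j)) 1) = Γ.mult i ((g : ℤ) - 1 - i)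
        ↔ (if i ∈ S then y i else 0) = t i := by
      rw [abel_sum_single, map_add, abel_single, abel_single, aj_v₁, aj_wLast, smul_zero, zero_add,
        smul_mult_one]
      have h1 := hcount (i + 1) i.2
      have h2 := hT.count_isStep hs i.succ
      have h3 := countFrom_add_not (fun i => x i ≠ 0) (i + 1) i.2
      have hlt : ((i : ℕ) + 1 ≤ k) ↔ i < k := Iff.rfl
      simp only [hlt] at h1
      simp only [Fin.val_succ] at h2
      push_cast at h3
      -- The remaining loops are those with `x ≠ 0` and those with `x = 0`; the latter are counted
      -- by the steps in direction `s`, of which `k` is missing from `S` as long as `i < k`.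
      have e : (g : ℤ) - 1 - i = (extend (p i.succ) s + if i < k then 1 else 0)
          + nz x (i + 1) - ((r : ℤ) - s) + countFrom (· ∈ S) (i + 1) := by
        rw [nz]
        omega
      rw [e, mult_add _ _ _ (countFrom _ _), mult_sub _ _ _ ((r : ℤ) - s),
        mult_add _ _ _ (nz x _)]
      simp only [t]
      generalize (if i ∈ S then y i else 0) = a
      constructor
      · intro h
        rw [← sub_eq_zero] at h ⊢
        rw [← h]
        abel
      · intro h
        rw [← sub_eq_zero] at h ⊢
        rw [← h]
        abel
    rw [hcond]
    constructor
    · intro h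
      by_contra hik
      by_cases hstep : IsStep x p s i
      · rw [if_pos ((hS i).2 ⟨hstep, hik⟩)] at h
        exact hy i h
      · rw [if_neg fun h' => hstep ((hS i).1 h').1] at h
        have h : x i = Γ.mult i (extend (p i.succ) s + if i < k then 1 else 0) :=
          (sub_eq_zero.1 h.symm).symm
        -- Loops not stepping in direction `s` carry no chip of `S`. Before `k` the condition is
        -- excluded by `linger` or `avoid`; after `k` by `avoid`, by genericity when `x i = 0`, or
        -- by `x i ≠ 0` when `s = r`.
        by_cases hx : x i = 0
        · rcases hs.lt_or_eq with hsr | hsr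
          · have hd : extend (p i.succ) s = extend (p i.castSucc) s - 1 := by
              rw [extend_of_lt _ hsr, extend_of_lt _ hsr, hT.down i hx]
              simp
            by_cases hlt : i < k
            · rw [if_pos hlt, hd, sub_add_cancel, extend_of_lt _ hsr] at h
              exact hT.avoid i _ h
            · rw [if_neg hlt, add_zero, hx, extend_of_lt _ hsr] at h
              exact hΓ.mult_ne_zero i ((hT.mem_chamber i.succ).2 _) (hT.le _ _) h.symm
          · exact hstep (Or.inr ⟨hsr, hx⟩)
        · have hd : extend (p i.succ) s = extend (p i.castSucc) s := by
            rcases hs.lt_or_eq with hsr | rfl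
            · rcases hT.up i hx ⟨s, hsr⟩ with h' | ⟨-, h'⟩
              · rw [extend_of_lt _ hsr, extend_of_lt _ hsr, h']
              · refine absurd (Or.inl ⟨hsr, ?_⟩) hstep
                rw [extend_of_lt _ hsr, extend_of_lt _ hsr, h']
                simp
            · simp
          by_cases hlt : i < k
          · rw [if_pos hlt, hd] at h
            exact hT.linger i hx s hs hd h
          · rw [if_neg hlt, add_zero, hd] at h
            rcases hs.lt_or_eq with hsr | rfl
            · rw [extend_of_lt _ hsr] at h
              exact hT.avoid i _ h
            · rw [extend_self, mult_zero] at h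
              exact hx h
    · rintro rfl
      rw [if_neg fun h => ((hS i).1 h).2 rfl]
      simp only [t, lt_irrefl, if_false, add_zero]
      rw [eq_comm, sub_eq_zero]
      rcases hk with ⟨hsr, h⟩ | ⟨rfl, h⟩
      · rw [h]
        by_cases hx : x i = 0
        · rw [extend_of_lt _ hsr, extend_of_lt _ hsr, hT.down i hx] at h
          simp only [Pi.sub_apply, Pi.one_apply] at h
          omega
        · rw [extend_of_lt _ hsr, extend_of_lt _ hsr] at h
          rcases hT.up i hx ⟨s, hsr⟩ with h' | ⟨h', -⟩
          · omega
          · rw [h', extend_of_lt _ hsr]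
      · rw [extend_self, mult_zero, h]

end ChainOfLoops

/-! ### Neighborhoods and translates in coordinates. -/

namespace ChainOfLoops
variable {g : ℕ} {Γ : ChainOfLoops g}

theorem rankAtLeast_zero {c : Γ.Pic} :
    Γ.RankAtLeast 0 c ↔ ∃ D : Γ.Divisor, 0 ≤ D ∧ cls D = c := by
  have h0 : cls (0 : Γ.Divisor) = 0 := rfl
  constructor
  · intro h
    simpa [h0] using h 0 le_rfl rfl
  · intro h E hE hdeg
    have : E = 0 := by
      ext P
      by_cases hP : P ∈ E.support
      · exact (Finset.sum_eq_zero_iff_of_nonneg fun P _ => hE P).1 hdeg P hP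
      · simpa using hP
    rw [this, h0, sub_zero]
    exact h

/-- The divisor `∑ q i - ∑ p i`. -/
def moveDivisor (p q : ∀ i, Γ.Loop i) : Γ.Divisor :=
  ∑ i, Finsupp.single (Γ.loopPt i (q i)) 1 - ∑ i, Finsupp.single (Γ.loopPt i (p i)) 1

theorem degHom_moveDivisor (p q : ∀ i, Γ.Loop i) : Γ.degHom (moveDivisor p q) = 0 := by
  simp [moveDivisor]

theorem abel_moveDivisor (p q : ∀ i, Γ.Loop i) (i : Fin g) :
    Γ.abel i (moveDivisor p q) = q i - p i := by
  rw [moveDivisor, map_sub, abel_sum_single, abel_sum_single]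
  simp

theorem mem_B_iff {p : ∀ i, Γ.Loop i} {D : Γ.Divisor} {ε : ℝ} {c : Γ.Pic} :
    c ∈ Γ.B p (cls D) ε ↔ ∃ q : ∀ i, Γ.Loop i, (∀ i, dist (p i) (q i) < ε) ∧
      c = cls (D + moveDivisor p q) := Iff.rfl

theorem mem_W_iff {r : ℕ} {d : ℤ} {D : Γ.Divisor} :
    cls D ∈ Γ.W r d ↔ Γ.degHom D = d ∧ Γ.RankAtLeast r (cls D) := by
  refine and_congr_left fun _ => ⟨?_, fun h => ⟨D, h, rfl⟩⟩
  rintro ⟨D', h, h'⟩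
  rw [← (cls_eq_iff.1 h').1]
  exact h

/-- The degree assumption puts the translated class in degree g - 1, where belonging to Θ is just
effectivity. -/
theorem mem_translate_iff {D E F : Γ.Divisor}
    (hdeg : Γ.degHom D - Γ.degHom E + Γ.degHom F = (g : ℤ) - 1) :
    cls D ∈ (fun θ => θ + cls (E - F)) '' Γ.Theta ↔
      ∃ D' : Γ.Divisor, 0 ≤ D' ∧ cls D' = cls (D - E + F) := by
  have e : cls (D - E + F) + cls (E - F) = cls D := by
    rw [← cls_add]
    congr 1
    abel
  have hT : cls (D - E + F) ∈ Γ.Theta ↔ ∃ D' : Γ.Divisor, 0 ≤ D' ∧ cls D' = cls (D - E + F) := by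
    rw [Theta, mem_W_iff, rankAtLeast_zero]
    refine and_iff_right ?_
    rw [map_add, map_sub, hdeg]
  rw [← hT]
  constructor
  · rintro ⟨θ, hθ, h⟩
    rw [← add_right_cancel (h.trans e.symm)]
    exact hθ
  · exact fun h => ⟨_, h, e⟩

end ChainOfLoops

end

/-! ### Proof of the proposition. -/

open ChainOfLoops

theorem proposition2p6 {g : ℕ} (Γ : ChainOfLoops g) (hΓ : Γ.IsGeneric) (r : ℕ) (d : ℤ)
    (p : ∀ i, Γ.Loop i) (hp : ∀ i, p i ≠ 0 ∧ p i ≠ Γ.mult i 1)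
    (c : Γ.Pic) (hc : c ∈ Γ.W r d) (hva : Γ.IsVertexAvoiding r d c) :
    ∃ n : ℕ, (n : ℤ) = (g : ℤ) - ChainOfLoops.rho g r d ∧
      ∃ E F : Fin n → Γ.Divisor,
        (∀ i, 0 ≤ E i ∧ ChainOfLoops.deg (E i) = r) ∧
        (∀ i, 0 ≤ F i ∧ ChainOfLoops.deg (F i) = (g : ℤ) - d + r - 1) ∧
        ∃ ε : ℝ, 0 < ε ∧
          (∀ i, ε ≤ dist (p i) 0 ∧ ε ≤ dist (p i) (Γ.mult i 1)) ∧
          Γ.W r d ∩ Γ.B p c ε =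
            (⋂ i, (fun θ => θ + ChainOfLoops.cls (E i - F i)) '' Γ.Theta) ∩ Γ.B p c ε := by
  classical
  obtain ⟨-, d₀, x, P, -, rfl, hpath, hcount, hw, hv⟩ := hva
  obtain ⟨hd, hrank⟩ := mem_W_iff.1 hc
  rw [degHom_dataDivisor] at hd
  have hpos : ∀ ε : ℝ, 0 < ε → ∀ᶠ δ in 𝓝[>] (0 : ℝ), δ ≤ ε := fun ε hε => by
    filter_upwards [Ioo_mem_nhdsGT hε] with δ hδ using hδ.2.le
  have hεp : ∀ᶠ ε in 𝓝[>] (0 : ℝ), ∀ i, ε ≤ dist (p i) 0 ∧ ε ≤ dist (p i) (Γ.mult i 1) :=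
    eventually_all.2 fun i =>
      (hpos _ (dist_pos.2 (hp i).1)).and (hpos _ (dist_pos.2 (hp i).2))
  have hε0 : ∀ᶠ ε in 𝓝[>] (0 : ℝ), 0 < ε := self_mem_nhdsWithin
  have hcs := count_steps (x := x) (p := P)
  have hnz := countFrom_add_not (fun i => x i ≠ 0) 0 (by omega)
  have hU := countFrom_nonneg (fun i => x i ≠ 0 ∧ P i.succ ≠ P i.castSucc) 0
  have hZ := countFrom_nonneg (fun i => ¬ x i ≠ 0) 0
  rw [hcount] at hcs
  -- A negative value would make ρ, which is the number of lingering loops, larger than g.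
  have hb : 0 ≤ (g : ℤ) - d + r := by
    by_contra hneg
    have : ((r : ℤ) + 1) * ((g : ℤ) - d + r) < 0 := mul_neg_of_pos_of_neg (by omega) (by omega)
    rw [rho] at hcs
    omega
  rcases hb.eq_or_lt with hb | hb
  -- Now d - r = g, and classes of degree g are effective because the walk loses at most one chip
  -- per loop.
  · refine ⟨0, by rw [rho, ← hb]; simp, fun i => i.elim0, fun i => i.elim0, fun i => i.elim0,
      fun i => i.elim0, ?_⟩
    obtain ⟨ε, h0, h1⟩ := (hε0.and hεp).exists
    refine ⟨ε, h0, h1, ?_⟩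
    rw [Set.iInter_of_empty, Set.univ_inter, Set.inter_eq_right]
    intro c' hc'
    obtain ⟨q, -, rfl⟩ := mem_B_iff.1 hc'
    have hdeg : Γ.degHom (Γ.dataDivisor d₀ x + moveDivisor p q) = d := by
      rw [map_add, degHom_moveDivisor, degHom_dataDivisor, hd, add_zero]
    refine mem_W_iff.2 ⟨hdeg, rankAtLeast_cls.2 fun E _ _ => ?_⟩
    refine le_trans ?_ (sub_le_leftWalk _ _ g)
    omega
  · obtain ⟨hT, hd₀⟩ := isTightPath hΓ hpath hd hb hcount hw hv hrank
    let A := {i : Fin g // ¬ (x i ≠ 0 ∧ P i.succ = P i.castSucc)}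
    have hA : (Fintype.card A : ℤ) = (g : ℤ) - rho g r d := by
      have h1 := countFrom_add_not (fun i => x i ≠ 0 ∧ P i.succ = P i.castSucc) 0 (by omega)
      have h2 : Fintype.card A = Set.ncard {i | ¬ (x i ≠ 0 ∧ P i.succ = P i.castSucc)} :=
        Nat.card_eq_fintype_card.symm
      rw [← hcount, h2, ncard_eq_countFrom, ncard_eq_countFrom]
      push_cast at h1
      omega
    have hex : ∀ k : A, ∃ E F : Γ.Divisor, 0 ≤ E ∧ Γ.degHom E = r ∧
        0 ≤ F ∧ Γ.degHom F = g - nz x 0 - 1 ∧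
        ∀ i, x i + Γ.mult i (nz x (i + 1)) - Γ.abel i E + Γ.abel i F
          = Γ.mult i ((g : ℤ) - 1 - i) ↔ i = k := by
      intro k
      obtain ⟨s, hs, hk⟩ := exists_isStep hT k.2
      exact hT.exists_translate hΓ hs hk
    choose E F hE0 hEdeg hF0 hFdeg hEF using hex
    have hF : ∀ k, Γ.degHom (F k) = (g : ℤ) - d + r - 1 := by
      intro k
      rw [hFdeg]
      omega
    -- The defect of the i-th theta condition at the given class. It vanishes only for `i = k`, and
    -- ε is taken below all the other defects, of which there are finitely many.
    let V : A → ∀ i, Γ.Loop i := fun k i =>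
      x i + Γ.mult i (nz x (i + 1)) - Γ.abel i (E k) + Γ.abel i (F k) - Γ.mult i ((g : ℤ) - 1 - i)
    have hεV : ∀ᶠ ε in 𝓝[>] (0 : ℝ), ∀ (k : A) (i : Fin g), i ≠ k → ε ≤ ‖V k i‖ := by
      refine eventually_all.2 fun k => eventually_all.2 fun i => ?_
      by_cases hik : i = k
      · exact Eventually.of_forall fun ε h => absurd hik h
      · filter_upwards [hpos ‖V k i‖ (norm_pos_iff.2 fun h =>
          hik ((hEF k i).1 (sub_eq_zero.1 h)))] with ε h _ using h
    obtain ⟨ε, h0, h1, hV⟩ := (hε0.and (hεp.and hεV)).exists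
    let e := (Fintype.equivFin A).symm
    refine ⟨Fintype.card A, hA, fun j => E (e j), fun j => F (e j), fun j => ⟨hE0 _, hEdeg _⟩,
      fun j => ⟨hF0 _, hF _⟩, ε, h0, h1, ?_⟩
    ext c'
    refine and_congr_left fun hc' => ?_
    obtain ⟨q, hq, rfl⟩ := mem_B_iff.1 hc'
    set D := Γ.dataDivisor d₀ x + moveDivisor p q with hD
    have hdeg : Γ.degHom D = d := by
      rw [hD, map_add, degHom_moveDivisor, degHom_dataDivisor, hd, add_zero]
    have habel : ∀ i, Γ.abel i D = (x i + (q i - p i)) + Γ.mult i (nz x (i + 1)) := by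
      intro i
      rw [hD, map_add, abel_moveDivisor, abel_dataDivisor]
      abel
    have htrans : ∀ k, cls D ∈ (fun θ => θ + cls (E k - F k)) '' Γ.Theta ↔
        ∃ D' : Γ.Divisor, 0 ≤ D' ∧ cls D' = cls (D - E k + F k) := fun k =>
      mem_translate_iff (by rw [hdeg, hEdeg, hF]; ring)
    rw [Set.mem_iInter]
    constructor
    · intro hW j
      rw [htrans]
      obtain ⟨D', hD', h'⟩ := hW.2 (E (e j)) (hE0 _) (hEdeg _)
      refine ⟨D' + F (e j), add_nonneg hD' (hF0 _), ?_⟩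
      rw [cls_add, h', ← cls_sub, ← cls_add]
    · intro h
      -- At the nearby class the i-th condition becomes `V k i = p i - q i`. For `i ≠ k` the right
      -- side is too small, and for `i = k` it forces `q k = p k`.
      have hfix : ∀ k : A, q k = p k := by
        intro k
        have hk := h (e.symm k)
        simp only [Equiv.apply_symm_apply] at hk
        rw [htrans, exists_effective_iff, map_add, map_sub, hdeg, hEdeg, hF,
          show d - (r : ℤ) + ((g : ℤ) - d + r - 1) = g - 1 by ring] at hk
        by_contra hne
        refine absurd (leftWalk_neg fun i hi => ?_) (not_lt.2 hk)
        simp only [map_add, map_sub, habel] at hi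
        have hVi : V k i = p i - q i := by
          simp only [V]
          rw [← hi]
          abel
        by_cases hik : i = k
        · subst hik
          have : V k k = 0 := sub_eq_zero.2 ((hEF k k).2 rfl)
          rw [this] at hVi
          exact hne (sub_eq_zero.1 hVi.symm).symm
        · have h2 := hV k i hik
          rw [hVi, ← dist_eq_norm] at h2
          exact absurd (hq i) (not_lt.2 h2)
      refine mem_W_iff.2 ⟨hdeg, hT.rankAtLeast (x' := fun i => x i + (q i - p i))
        (by rw [hdeg, ← hd, hd₀]) habel (fun i hx => ?_) fun i hx j => ?_⟩
      · rw [hfix ⟨i, fun h => h.1 hx⟩, sub_self, add_zero, hx]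
      · by_cases hl : P i.succ = P i.castSucc
        · exact Or.inl (by rw [hl])
        · simp only [hfix ⟨i, fun h => hl h.2⟩, sub_self, add_zero]
          exact hT.up i hx j
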